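/- **Setting.** Let $N,n\ge 1$ and $d\ge 1$ be integers, let $x_0\in\mathbb R^n$, and let $(\Omega,\mathcal F,\mathbb P)$ be a probability space. For $k\ge 0$ and $i,j\in\mathcal V=\{1,\dots,N\}$ let $H_i(k)$ be random $n_i\times n$ matrices, $v_i(k)$ random vectors in $\mathbb R^{n_i}$, $\mathcal A(k)=[a_{ij}(k)]$ random real $N\times N$ matrices with $a_{ii}(k)=0$ a.s., and $\lambda_{ji}(k)$ random variables with values in $\{0,\dots,d\}$ and $\lambda_{ii}(k)=0$ a.s. Put $z_i(k)=H_i(k)x_0+v_i(k)$ and $v(k)=[v_1(k)^T,\dots,v_N(k)^T]^T$. For positive sequences $a(k),b(k)$ and deterministic initial estimates $x_i(t)\in\mathbb R^n$ ($t\le 0$), consider the algorithm $$x_i(k+1)=x_i(k)+a(k)H_i^T(k)\big(z_i(k)-H_i(k)x_i(k)\big)+b(k)\sum_{j:\,a_{ij}(k)\ne 0}a_{ij}(k)\big(x_j(k-\lambda_{ji}(k))-x_i(k)\big),\quad i\in\mathcal V,\ k\ge 0.$$ **Notation.** Let $\mathcal F(k)=\sigma(\mathcal A(s),v(s),H_i(s),\lambda_{ji}(s):\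 i,j\in\mathcal V,\ 0\le s\le k)$, and let $\mathcal F(-1)$ be trivial. Let $\mathcal D(k)$ be the diagonal matrix with entries $\sum_j a_{ij}(k)$, $\mathcal L(k)=\mathcal D(k)-\mathcal A(k)$, $\widehat{\mathcal L}(k)=\frac12(\mathcal L(k)+\mathcal L(k)^T)$, $\mathcal H(k)=\mathrm{diag}(H_1(k),\dots,H_N(k))$, and let $\overline A(k,q)=B(k,q)\otimes I_n$, where $B(k,q)$ is the $N\times N$ matrix with $(i,j)$ entry $a_{ij}(k)\mathbf 1_{\{\lambda_{ji}(k)=q\}}$, $0\le q\le d$. Let $F(k)=I_{Nn}$ for $k<0$ and, recursively for $k\ge 0$, $$F(k)=I_{Nn}-b(k)\mathcal D(k)\otimes I_n-a(k)\mathcal H^T(k)\mathcal H(k)+b(k)\sum_{q=0}^d\overline A(k,q)\,[\Phi_F(k-1,k-q)]^{-1},$$ where $\Phi_F(j,i)=F(j)F(j-1)\cdots F(i)$ for $j\ge i$ and $\Phi_F(j,i)=I_{Nn}$ for $j<i$ (under the assumptions below, all $F(k)$ are a.s. invertible). With $\|\cdot\|$ the Euclidean norm of vectors and the induced 2-norm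 of matrices, and $\lambda_{\min}$ the minimum eigenvalue of a symmetric matrix, put, for integers $h\ge1$ and $m\ge 0$, $$\lambda_m^h=\lambda_{\min}\Big[\sum_{k=mh}^{(m+1)h-1}\Big(\tfrac{b(k)}{a(k)}\mathbb E[\widehat{\mathcal L}(k)\,|\,\mathcal F(mh-1)]\otimes I_n+\mathbb E[\mathcal H^T(k)\mathcal H(k)\,|\,\mathcal F(mh-1)]\Big)\Big],$$ $$\Delta_m^h=\sum_{k=mh}^{(m+1)h-1}\tfrac{b(k)}{a(k)}\sum_{q=0}^d\Big\|\mathbb E\big[\overline A(k,q)\big([\Phi_F(k-1,k-q)]^{-1}-I_{Nn}\big)\,\big|\,\mathcal F(mh-1)\big]\Big\|.$$ **Assumptions.** (i) The sequence $\{v(k)\}$ is independent of the joint family $\{H_i(k),\mathcal A(k),\lambda_{ji}(k):\ i,j\in\mathcal V,\ k\ge 0\}$. (ii) $\{v(k),\mathcal F(k)\}_{k\ge0}$ is a martingale difference sequence, and $\sup_{k\ge0}\mathbb E[\|v(k)\|^2|\mathcal F(k-1)]\le\beta_v$ a.s. for some constant $\beta_v>0$. (iii) There are constants $\beta_a,\beta_H>0$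 with $|a_{ij}(k)|\le\beta_a$ and $\|H_i(k)\|\le\beta_H$ a.s. for all $i,j\in\mathcal V$ and $k\ge0$. (iv) $a(k)$ and $b(k)$ are positive and decrease monotonically to zero, $a(k)=O(b(k))$, $a(k)=O(a(k+m))$ for every fixed integer $m\ge 1$, $b^2(k)=o(a(k))$, and $\sum_{k}a(k)=\infty$. (v) For a constant $C_a$ with $a(k)\le C_a b(k)$ for all $k\ge 0$, $$\sup_{k\ge0}b(k)<\sup_{0<\kappa<1}\min\Big\{\frac{\kappa}{2[N\beta_a+N\sqrt N\beta_a+C_a\beta_H^2]},\ \frac{(1-(1-\kappa)^{-1})\kappa}{2N\sqrt N\beta_a(1-(1-\kappa)^{-(d+1)})}\Big\}.$$ **Statement.** Under (i)–(v), if there are a positive integer $h$ and a constant $\theta$ such that $\inf_{m\ge 0}(\lambda_m^h-\Delta_m^h)\ge\theta>0$ a.s., then the algorithm converges in mean square: $\lim_{k\to\infty}\mathbb E\|x_i(k)-x_0\|^2=0$ for every $i\in\mathcal V$. -/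

import Mathlib

open MeasureTheory ProbabilityTheory Filter Topology Asymptotics
open scoped Matrix Kronecker Matrix.Norms.L2Operator

noncomputable section

namespace CoopEst

/-! ### Matrix notions -/

/-- Minimum eigenvalue of a real symmetric matrix: the least element of its spectrum. -/
def lamMin {ι : Type*} [Fintype ι] [DecidableEq ι] (M : Matrix ι ι ℝ) : ℝ :=
  sInf (spectrum ℝ M)

/-- Entrywise conditional expectation of a random matrix. -/
def condExpMat {Ω ι κ : Type*} [mΩ : MeasurableSpace Ω] (μ : Measure Ω) (m : MeasurableSpace Ω)
    (M : Ω → Matrix ι κ ℝ) (ω : Ω) : Matrix ι κ ℝ :=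
  Matrix.of fun i j => (μ[fun ω' => M ω' i j | m]) ω

/-- `transProd Z j i = Z(j) Z(j-1) ⋯ Z(i)` for `j ≥ i`, and the identity for `j < i`. -/
def transProd {R : Type*} [Monoid R] (Z : ℤ → R) (j i : ℤ) : R :=
  ((List.range (j + 1 - i).toNat).map fun s : ℕ => Z (j - s)).prod

/-- The product only sees the factors with index in `[i, j]`. -/
theorem transProd_congr {R : Type*} [Monoid R] {Z W : ℤ → R} {j i : ℤ}
    (h : ∀ t, t ≤ j → Z t = W t) : transProd Z j i = transProd W j i := by
  unfold transProd
  congr 1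
  exact List.map_congr_left fun s _ => h _ (by omega)

/-! ### The network -/

/-- The random data of the estimation problem on `N` nodes: unknown parameter `x₀ ∈ ℝⁿ`,
observation matrices `H k i` of size `p i × n`, stacked measurement noise `v k`, weighted
adjacency matrices `adj k` (entry `(i, j)` is the weight of the link from `j` to `i`), delays
`delay k j i ∈ {0, …, d}` of the link from `j` to `i`, gains `a` (innovation) and `b` (consensus),
and the deterministic initial estimates `init t i` for `t ≤ 0`. -/
structure Network {Ω : Type*} [MeasurableSpace Ω] (μ : Measure Ω) (N n d : ℕ)
    (p : Fin N → ℕ) where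
  x₀ : EuclideanSpace ℝ (Fin n)
  H : ℕ → (i : Fin N) → Ω → Matrix (Fin (p i)) (Fin n) ℝ
  v : ℕ → Ω → EuclideanSpace ℝ (Σ i : Fin N, Fin (p i))
  adj : ℕ → Ω → Matrix (Fin N) (Fin N) ℝ
  delay : ℕ → Fin N → Fin N → Ω → Fin (d + 1)
  a : ℕ → ℝ
  b : ℕ → ℝ
  init : ℤ → Fin N → EuclideanSpace ℝ (Fin n)
  measurable_H : ∀ k i r c, Measurable fun ω => H k i ω r c
  measurable_v : ∀ k, Measurable (v k)
  measurable_adj : ∀ k i j, Measurable fun ω => adj k ω i j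
  measurable_delay : ∀ k j i, Measurable (delay k j i)
  adj_diag : ∀ k i, ∀ᵐ ω ∂μ, adj k ω i i = 0
  delay_self : ∀ k i, ∀ᵐ ω ∂μ, delay k i i ω = 0

namespace Network

variable {Ω : Type*} [MeasurableSpace Ω] {μ : Measure Ω} {N n d : ℕ} {p : Fin N → ℕ}
  (S : Network μ N n d p)

/-- The noise `vᵢ(k)` of node `i`. -/
def noise (k : ℕ) (i : Fin N) (ω : Ω) : EuclideanSpace ℝ (Fin (p i)) :=
  WithLp.toLp 2 fun r => S.v k ω ⟨i, r⟩

/-- The measurement `zᵢ(k) = Hᵢ(k) x₀ + vᵢ(k)`. -/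
def meas (k : ℕ) (i : Fin N) (ω : Ω) : EuclideanSpace ℝ (Fin (p i)) :=
  Matrix.toEuclideanLin (S.H k i ω) S.x₀ + S.noise k i ω

/-- One step of the algorithm: the new estimate of node `i` computed at time `k` from the
history `x` (of which only the values at times `k - d, …, k` are used). -/
def algStep (k : ℕ) (ω : Ω) (x : ℤ → Fin N → EuclideanSpace ℝ (Fin n)) (i : Fin N) :
    EuclideanSpace ℝ (Fin n) :=
  x k i
    + S.a k • Matrix.toEuclideanLin (S.H k i ω)ᵀ
        (S.meas k i ω - Matrix.toEuclideanLin (S.H k i ω) (x k i))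
    + S.b k • ∑ j ∈ Finset.univ.filter (fun j => S.adj k ω i j ≠ 0),
        S.adj k ω i j • (x ((k : ℤ) - ((S.delay k j i ω : ℕ) : ℤ)) j - x k i)

/-- The estimates `xᵢ(t)`: the initial values for `t ≤ 0`, and
`x(k+1) = algStep k x` for `k ≥ 0`. -/
def estimate (ω : Ω) (t : ℤ) : Fin N → EuclideanSpace ℝ (Fin n) :=
  if 0 < t then
    S.algStep (t - 1).toNat ω fun s => if s < t then estimate ω s else 0
  else S.init t
termination_by t.toNat
decreasing_by omega

theorem estimate_of_nonpos (ω : Ω) {t : ℤ} (ht : t ≤ 0) : S.estimate ω t = S.init t := by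
  rw [estimate, if_neg (by omega)]

/-- The algorithm. -/
theorem estimate_succ (ω : Ω) (k : ℕ) (i : Fin N) :
    S.estimate ω (k + 1) i = S.algStep k ω (S.estimate ω) i := by
  rw [estimate, if_pos (by omega)]
  have hk : ((k : ℤ) + 1 - 1).toNat = k := by omega
  rw [hk]
  unfold algStep
  have h0 : (k : ℤ) < (k : ℤ) + 1 := by omega
  have h1 : ∀ q : ℕ, (k : ℤ) - (q : ℤ) < (k : ℤ) + 1 := fun q => by omega
  simp only [h0, h1, if_true]

/-! ### Sigma-fields -/

/-- `σ(v(s))`. -/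
@[reducible] def sigmaNoise (s : ℕ) : MeasurableSpace Ω := MeasurableSpace.comap (S.v s) inferInstance

/-- `σ(A(s), Hᵢ(s), λⱼᵢ(s))`. -/
@[reducible] def sigmaSystem (s : ℕ) : MeasurableSpace Ω :=
  (⨆ (i) (j), MeasurableSpace.comap (fun ω => S.adj s ω i j) inferInstance)
    ⊔ (⨆ (i) (r) (c), MeasurableSpace.comap (fun ω => S.H s i ω r c) inferInstance)
    ⊔ (⨆ (j) (i), MeasurableSpace.comap (S.delay s j i) inferInstance)

/-- `past k` is the sigma-field `ℱ(k-1)` generated by all the data at times `0, …, k - 1`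
(so that `past 0 = ℱ(-1)` is trivial). -/
@[reducible] def past (k : ℕ) : MeasurableSpace Ω := ⨆ s ∈ Set.Iio k, S.sigmaNoise s ⊔ S.sigmaSystem s

/-! ### Compact form -/

/-- The degree matrix. -/
def degMat (k : ℕ) (ω : Ω) : Matrix (Fin N) (Fin N) ℝ :=
  Matrix.diagonal fun i => ∑ j, S.adj k ω i j

/-- The Laplacian matrix. -/
def lapl (k : ℕ) (ω : Ω) : Matrix (Fin N) (Fin N) ℝ := S.degMat k ω - S.adj k ω

/-- The symmetrized Laplacian matrix. -/
def laplSym (k : ℕ) (ω : Ω) : Matrix (Fin N) (Fin N) ℝ :=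
  (1 / 2 : ℝ) • (S.lapl k ω + (S.lapl k ω)ᵀ)

/-- The block diagonal matrix `diag(H₁(k), …, H_N(k))`. -/
def Hdiag (k : ℕ) (ω : Ω) : Matrix (Σ i : Fin N, Fin (p i)) (Fin N × Fin n) ℝ :=
  Matrix.of fun r c => if r.1 = c.1 then S.H k r.1 ω r.2 c.2 else 0

/-- The delay matrix: its `(i, j)` entry tells whether the link from `j` to `i` has delay `q`. -/
def delayMat (k q : ℕ) (ω : Ω) : Matrix (Fin N) (Fin N) ℝ :=
  Matrix.of fun i j => if (S.delay k j i ω : ℕ) = q then 1 else 0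

/-- `(A(k) ∘ I(k,q)) ⊗ Iₙ`. -/
def Abar (k q : ℕ) (ω : Ω) : Matrix (Fin N × Fin n) (Fin N × Fin n) ℝ :=
  (S.adj k ω ⊙ S.delayMat k q ω) ⊗ₖ (1 : Matrix (Fin n) (Fin n) ℝ)

/-! ### The transition matrices of the equivalent system without delays -/

/-- `G(k) = b(k) D(k) ⊗ Iₙ + a(k) H(k)ᵀ H(k) - b(k) ∑_{q ≤ d} Ā(k,q) [Φ_F(k-1,k-q)]⁻¹`,
as a function of the earlier matrices `F`. -/
def Gmat (k : ℕ) (ω : Ω) (F : ℤ → Matrix (Fin N × Fin n) (Fin N × Fin n) ℝ) :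
    Matrix (Fin N × Fin n) (Fin N × Fin n) ℝ :=
  S.b k • (S.degMat k ω ⊗ₖ (1 : Matrix (Fin n) (Fin n) ℝ))
    + S.a k • ((S.Hdiag k ω)ᵀ * S.Hdiag k ω)
    - S.b k • ∑ q ∈ Finset.range (d + 1),
        S.Abar k q ω * (transProd F ((k : ℤ) - 1) ((k : ℤ) - q))⁻¹

/-- `F(k) = I - G(k)` for `k ≥ 0`, and `F(k) = I` for `k < 0`. -/
def F (ω : Ω) (t : ℤ) : Matrix (Fin N × Fin n) (Fin N × Fin n) ℝ :=
  if 0 ≤ t then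
    1 - S.Gmat t.toNat ω fun s => if s < t then F ω s else 1
  else 1
termination_by (t + 1).toNat
decreasing_by omega

theorem F_of_neg (ω : Ω) {t : ℤ} (ht : t < 0) : S.F ω t = 1 := by
  rw [F, if_neg (by omega)]

theorem F_natCast (ω : Ω) (k : ℕ) : S.F ω k = 1 - S.Gmat k ω (S.F ω) := by
  rw [F, if_pos (by omega), Int.toNat_natCast]
  unfold Gmat
  congr 2
  congr 1
  refine Finset.sum_congr rfl fun q _ => ?_
  rw [transProd_congr (W := S.F ω) fun t ht => if_pos (by omega)]

/-- `C_q(k) = - b(k) ∑_{q ≤ r ≤ d} Ā(k,r) [Φ_F(k-q,k-r)]⁻¹`. -/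
def C (q k : ℕ) (ω : Ω) : Matrix (Fin N × Fin n) (Fin N × Fin n) ℝ :=
  -(S.b k • ∑ r ∈ Finset.Icc q d,
    S.Abar k r ω * (transProd (S.F ω) ((k : ℤ) - q) ((k : ℤ) - r))⁻¹)

/-- First equation of the system that determines `F` and `C_1, …, C_d`. -/
theorem F_add_C_one (ω : Ω) (k : ℕ) :
    S.F ω k + S.C 1 k ω =
      1 - S.b k • (S.degMat k ω ⊗ₖ (1 : Matrix (Fin n) (Fin n) ℝ))
        - S.a k • ((S.Hdiag k ω)ᵀ * S.Hdiag k ω) + S.b k • S.Abar k 0 ω := by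
  have hs : ∀ f : ℕ → Matrix (Fin N × Fin n) (Fin N × Fin n) ℝ,
      ∑ q ∈ Finset.range (d + 1), f q = f 0 + ∑ q ∈ Finset.Icc 1 d, f q := by
    intro f
    rw [Finset.sum_range_succ', add_comm, Finset.range_eq_Ico, Finset.sum_Ico_add' f 0 d 1]
    rfl
  rw [F_natCast, Gmat, C, hs]
  have h0 : transProd (S.F ω) ((k : ℤ) - 1) ((k : ℤ) - (0 : ℕ)) = 1 := by
    simp [transProd]
  rw [h0, inv_one, mul_one, smul_add, Nat.cast_one]
  abel

/-- The other equations of the system, `C_q(k) F(k-q) - C_{q+1}(k) = - b(k) Ā(k,q)` for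
`1 ≤ q ≤ d` (where `C_{d+1} = 0`), hold as soon as `F(k-q)` is invertible. -/
theorem C_mul_F_sub (ω : Ω) (k q : ℕ) (hq : q ≤ d) (hF : IsUnit (S.F ω ((k : ℤ) - q)).det) :
    S.C q k ω * S.F ω ((k : ℤ) - q) - S.C (q + 1) k ω = -(S.b k • S.Abar k q ω) := by
  have hstep : ∀ r ∈ Finset.Icc (q + 1) d,
      S.Abar k r ω * (transProd (S.F ω) ((k : ℤ) - q) ((k : ℤ) - r))⁻¹ * S.F ω ((k : ℤ) - q)
        = S.Abar k r ω * (transProd (S.F ω) ((k : ℤ) - (q + 1 : ℕ)) ((k : ℤ) - r))⁻¹ := by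
    intro r hr
    have hr' := (Finset.mem_Icc.mp hr).1
    have hT : transProd (S.F ω) ((k : ℤ) - q) ((k : ℤ) - r) =
        S.F ω ((k : ℤ) - q) * transProd (S.F ω) ((k : ℤ) - (q + 1 : ℕ)) ((k : ℤ) - r) := by
      unfold transProd
      have e1 : ((k : ℤ) - q + 1 - (k - r)).toNat = (r - q) + 1 := by omega
      have e2 : ((k : ℤ) - (q + 1 : ℕ) + 1 - (k - r)).toNat = r - q := by omega
      rw [e1, e2, List.range_succ_eq_map, List.map_cons, List.prod_cons, List.map_map]
      congr 1
      · simp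
      · congr 1
        refine List.map_congr_left fun s _ => ?_
        simp only [Function.comp]
        congr 1
        push_cast
        ring
    rw [hT, Matrix.mul_inv_rev, Matrix.mul_assoc, Matrix.mul_assoc, Matrix.nonsing_inv_mul _ hF,
      Matrix.mul_one]
  have hsplit : ∀ f : ℕ → Matrix (Fin N × Fin n) (Fin N × Fin n) ℝ,
      ∑ r ∈ Finset.Icc q d, f r = f q + ∑ r ∈ Finset.Icc (q + 1) d, f r := by
    intro f
    have e : Finset.Icc (q + 1) d = Finset.Ioc q d := by
      ext r
      simp only [Finset.mem_Icc, Finset.mem_Ioc]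
      omega
    rw [e, Finset.add_sum_Ioc_eq_sum_Icc hq]
  have hqq : transProd (S.F ω) ((k : ℤ) - q) ((k : ℤ) - q) = S.F ω ((k : ℤ) - q) := by
    simp [transProd]
  rw [C, C, hsplit, neg_mul, smul_mul_assoc, add_mul, Finset.sum_mul, Finset.sum_congr rfl hstep,
    hqq, Matrix.mul_assoc, Matrix.nonsing_inv_mul _ hF, Matrix.mul_one, smul_add]
  abel

/-! ### The quantities in the convergence condition -/

/-- `λ_m^h`. -/
def lam (h m : ℕ) (ω : Ω) : ℝ :=
  lamMin (∑ k ∈ Finset.Ico (m * h) ((m + 1) * h),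
    ((S.b k / S.a k) •
        (condExpMat μ (S.past (m * h)) (S.laplSym k) ω ⊗ₖ (1 : Matrix (Fin n) (Fin n) ℝ))
      + condExpMat μ (S.past (m * h)) (fun ω' => (S.Hdiag k ω')ᵀ * S.Hdiag k ω') ω))

/-- `Δ_m^h`. -/
def Delta (h m : ℕ) (ω : Ω) : ℝ :=
  ∑ k ∈ Finset.Ico (m * h) ((m + 1) * h), S.b k / S.a k *
    ∑ q ∈ Finset.range (d + 1),
      ‖condExpMat μ (S.past (m * h))
        (fun ω' => S.Abar k q ω' *
          ((transProd (S.F ω') ((k : ℤ) - 1) ((k : ℤ) - q))⁻¹ - 1)) ω‖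

/-! ### Assumptions -/

/-- The noise sequence is independent of the graphs, observation matrices and delays. -/
def NoiseIndep : Prop := Indep (⨆ k, S.sigmaNoise k) (⨆ k, S.sigmaSystem k) μ

/-- The noise is a square integrable martingale difference sequence whose conditional second
moments are bounded by a constant. -/
def NoiseMartingaleDiff : Prop :=
  (∀ k, MemLp (S.v k) 2 μ) ∧ (∀ k, μ[S.v k | S.past k] =ᵐ[μ] 0) ∧
    ∃ βv : ℝ, 0 < βv ∧ ∀ k, ∀ᵐ ω ∂μ, (μ[fun ω' => ‖S.v k ω'‖ ^ 2 | S.past k]) ω ≤ βv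

/-- Almost surely `|a_{ij}(k)| ≤ βa` and `‖H_i(k)‖ ≤ βH` for all `i, j, k`. -/
def BoundedBy (βa βH : ℝ) : Prop :=
  0 < βa ∧ 0 < βH ∧ (∀ᵐ ω ∂μ, ∀ k i j, |S.adj k ω i j| ≤ βa) ∧
    ∀ᵐ ω ∂μ, ∀ k i, ‖S.H k i ω‖ ≤ βH

/-- The asymptotic conditions on the gains. -/
def GainsDecay : Prop :=
  (∀ k, 0 < S.a k) ∧ (∀ k, 0 < S.b k) ∧ Antitone S.a ∧ Antitone S.b ∧
    Tendsto S.a atTop (𝓝 0) ∧ Tendsto S.b atTop (𝓝 0) ∧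
    S.a =O[atTop] S.b ∧ (∀ m : ℕ, 0 < m → S.a =O[atTop] fun k => S.a (k + m)) ∧
    (fun k => S.b k ^ 2) =o[atTop] S.a ∧
    Tendsto (fun K => ∑ k ∈ Finset.range K, S.a k) atTop atTop

/-- The smallness condition on the consensus gain, for given bounds `βa`, `βH`, and a constant
`Ca` with `a ≤ Ca b`. -/
def GainsSmall (βa βH Ca : ℝ) : Prop :=
  (∀ k, S.a k ≤ Ca * S.b k) ∧
    (⨆ k, S.b k) < ⨆ κ : Set.Ioo (0 : ℝ) 1,
      min ((κ : ℝ) / (2 * (N * βa + N * √N * βa + Ca * βH ^ 2)))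
        ((1 - (1 - (κ : ℝ))⁻¹) * κ /
          (2 * N * √N * βa * (1 - (1 - (κ : ℝ)) ^ (-((d : ℤ) + 1)))))

/-- Mean square convergence of all estimates to the true parameter (the expectations are those of
integrable random variables). -/
def ConvergesInMeanSquare : Prop :=
  ∀ i : Fin N,
    (∀ k : ℕ, Integrable (fun ω => ‖S.estimate ω k i - S.x₀‖ ^ 2) μ) ∧
      Tendsto (fun k : ℕ => ∫ ω, ‖S.estimate ω k i - S.x₀‖ ^ 2 ∂μ) atTop (𝓝 0)

end Network

end CoopEst

end

/-! Let e(k) be the stacked error and r(k) = e(k+1) − F(k)e(k) its defect with respect to the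
delay-free system. By the choice of F, r(k) is the observed noise a(k)H(k)ᵀv(k) plus b(k) times a
sum of terms Ā(k,q)(e(k−q) − [Φ_F(k−1,k−q)]⁻¹e(k)), as `res_natCast` shows. The smallness condition
on b gives ‖I − F(k)‖ ≤ κ < 1 by induction on k (`isUnit_F_and_norm_inv_le`), so one can step
backwards through F with bounded inverses, and each bracket is a bounded combination of r(k−1), …,
r(k−q) (`norm_err_sub_le`). Thus r satisfies a recursion in itself with the small factor b(k). It
follows that E‖r(k)‖² = O(a(k)²), while the part due to delays is O(a(k)²b(k)²)
(`exists_integral_res_le`): the delays have become a perturbation of higher order.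

Write G = I − F. Over a block of length h, e(k+h) equals e(k) − ∑ G(k+l)e(k) plus noise plus a
remainder, and ‖e(k+h)‖² is expanded. The noise term is orthogonal to e(k): v(k+l) has mean zero
given the earlier noise, and independence allows the whole system to be adjoined to the
conditioning. For the drift, G(k)/a(k) has the quadratic form of (b/a)L̂⊗I + HᵀH minus the terms
that Δ measures; conditioning at the start of the block bounds the sum of E⟨e, G(k+l)e⟩/a(k+l) below
by θE‖e‖² (`mul_mse_le_sum`). Replacing each a(k+l) by the gain at the start of the block costs a
telescoping difference of √a, because ‖G‖ = O(b) and b = O(√a). Young's inequality puts everything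
else into o(a)E‖e‖² + o(a).

So V(m) = E‖e(mh)‖² satisfies V(m+1) ≤ (1 − θa(mh) + ε_m)V(m) + ζ_m θa(mh) for large m, with ∑ε_m <
∞, ζ_m → 0 and ∑a(mh) = ∞, and `tendsto_zero_of_gain_recursion_of_summable` gives V → 0. A crude
increment bound fills in the times inside a block. -/

namespace CoopEst

/-! ### Matrices acting on Euclidean vectors: quadratic forms and operator norms. -/

section MatrixAction

variable {ι κ l : Type*} [Fintype ι] [Fintype l]

/-- The action of a real matrix on Euclidean vectors. -/
noncomputable def act (M : Matrix κ ι ℝ) (x : EuclideanSpace ℝ ι) : EuclideanSpace ℝ κ :=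
  WithLp.toLp 2 (M *ᵥ WithLp.ofLp x)

theorem act_apply (M : Matrix κ ι ℝ) (x : EuclideanSpace ℝ ι) (i : κ) :
    act M x i = ∑ j, M i j * x j := rfl

theorem act_sub (M : Matrix κ ι ℝ) (x y : EuclideanSpace ℝ ι) :
    act M (x - y) = act M x - act M y := by
  simp [act, Matrix.mulVec_sub]

theorem add_act (M M' : Matrix κ ι ℝ) (x : EuclideanSpace ℝ ι) :
    act (M + M') x = act M x + act M' x := by
  simp [act, Matrix.add_mulVec]

theorem sub_act (M M' : Matrix κ ι ℝ) (x : EuclideanSpace ℝ ι) :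
    act (M - M') x = act M x - act M' x := by
  simp [act, Matrix.sub_mulVec]

theorem smul_act (c : ℝ) (M : Matrix κ ι ℝ) (x : EuclideanSpace ℝ ι) :
    act (c • M) x = c • act M x := by
  simp [act, Matrix.smul_mulVec]

theorem sum_act {α : Type*} (s : Finset α) (M : α → Matrix κ ι ℝ) (x : EuclideanSpace ℝ ι) :
    act (∑ a ∈ s, M a) x = ∑ a ∈ s, act (M a) x := by
  classical
  induction s using Finset.induction_on with
  | empty => simp [act]
  | insert a s ha ih => rw [Finset.sum_insert ha, Finset.sum_insert ha, add_act, ih]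

theorem one_act [DecidableEq ι] (x : EuclideanSpace ℝ ι) : act (1 : Matrix ι ι ℝ) x = x := by
  simp [act]

theorem mul_act (M : Matrix κ ι ℝ) (M' : Matrix ι l ℝ) (x : EuclideanSpace ℝ l) :
    act (M * M') x = act M (act M' x) := by
  simp [act, Matrix.mulVec_mulVec]

theorem norm_act_le [Fintype κ] [DecidableEq ι] (M : Matrix κ ι ℝ) (x : EuclideanSpace ℝ ι) :
    ‖act M x‖ ≤ ‖M‖ * ‖x‖ :=
  Matrix.l2_opNorm_mulVec M x

theorem opNorm_le_of_act [Fintype κ] [DecidableEq ι] (M : Matrix κ ι ℝ) {c : ℝ} (hc : 0 ≤ c)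
    (h : ∀ x, ‖act M x‖ ^ 2 ≤ (c * ‖x‖) ^ 2) : ‖M‖ ≤ c := by
  rw [Matrix.l2_opNorm_def]
  refine ContinuousLinearMap.opNorm_le_bound _ hc fun x => ?_
  exact abs_le_of_sq_le_sq' (h x) (by positivity) |>.2

theorem inner_act [Fintype κ] (M : Matrix κ ι ℝ) (x : EuclideanSpace ℝ ι) (y : EuclideanSpace ℝ κ) :
    inner ℝ y (act M x) = ∑ i, ∑ j, y i * (x j * M i j) := by
  simp only [PiLp.inner_apply, act_apply, RCLike.inner_apply, conj_trivial, Finset.sum_mul]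
  refine Finset.sum_congr rfl fun i _ => Finset.sum_congr rfl fun j _ => by ring

theorem inner_act_transpose [Fintype κ] (M : Matrix κ ι ℝ) (x : EuclideanSpace ℝ ι) (y : EuclideanSpace ℝ κ) :
    inner ℝ x (act Mᵀ y) = inner ℝ y (act M x) := by
  rw [inner_act, inner_act, Finset.sum_comm]
  refine Finset.sum_congr rfl fun i _ => Finset.sum_congr rfl fun j _ => ?_
  rw [Matrix.transpose_apply]; ring

theorem abs_inner_act_le [DecidableEq ι] (M : Matrix ι ι ℝ) (x : EuclideanSpace ℝ ι) :
    |inner ℝ x (act M x)| ≤ ‖M‖ * ‖x‖ ^ 2 := by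
  calc |inner ℝ x (act M x)| ≤ ‖x‖ * ‖act M x‖ := abs_real_inner_le_norm _ _
    _ ≤ ‖x‖ * (‖M‖ * ‖x‖) := by gcongr; exact norm_act_le M x
    _ = ‖M‖ * ‖x‖ ^ 2 := by ring

theorem abs_entry_le_norm [Fintype κ] [DecidableEq ι] (M : Matrix κ ι ℝ) (i : κ) (j : ι) :
    |M i j| ≤ ‖M‖ := by
  have h := norm_act_le M (EuclideanSpace.single j (1 : ℝ))
  have h2 : act M (EuclideanSpace.single j (1 : ℝ)) i = M i j := by
    simp [act_apply]
  have h3 := PiLp.norm_apply_le (act M (EuclideanSpace.single j (1 : ℝ))) i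
  rw [h2, Real.norm_eq_abs] at h3
  simpa using h3.trans h

/-- The quadratic form of a symmetric matrix is bounded below by its minimum eigenvalue. -/
theorem lamMin_mul_norm_sq_le [DecidableEq ι] {M : Matrix ι ι ℝ} (hM : M.IsHermitian)
    (x : EuclideanSpace ℝ ι) : lamMin M * ‖x‖ ^ 2 ≤ inner ℝ x (act M x) := by
  have hH : (M - lamMin M • (1 : Matrix ι ι ℝ)).IsHermitian := by
    refine hM.sub ?_
    rw [Matrix.IsHermitian, Matrix.conjTranspose_smul, Matrix.conjTranspose_one]
    simp
  have hps : (M - lamMin M • (1 : Matrix ι ι ℝ)).PosSemidef := by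
    rw [hH.posSemidef_iff_eigenvalues_nonneg]
    intro i
    have h1 := hH.eigenvalues_mem_spectrum_real i
    -- Subtracting a scalar matrix translates the spectrum, so an eigenvalue of the shifted matrix
    -- is a spectral value of M minus the least one.
    have h2 : lamMin M + hH.eigenvalues i ∈ spectrum ℝ M := by
      have h4 := spectrum.add_mem_add_iff (R := ℝ) (a := M - lamMin M • (1 : Matrix ι ι ℝ))
        (r := hH.eigenvalues i) (s := lamMin M)
      rw [Algebra.algebraMap_eq_smul_one] at h4
      have h5 := h4.2 h1
      rw [show lamMin M • (1 : Matrix ι ι ℝ) + (M - lamMin M • (1 : Matrix ι ι ℝ)) = M by abel] at h5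
      rwa [add_comm]
    have h3 : lamMin M ≤ lamMin M + hH.eigenvalues i :=
      csInf_le (Matrix.finite_real_spectrum (A := M)).bddBelow h2
    show (0 : ℝ) ≤ hH.eigenvalues i
    linarith
  have h := hps.re_dotProduct_nonneg (WithLp.ofLp x)
  have e : inner ℝ x (act (M - lamMin M • (1 : Matrix ι ι ℝ)) x)
      = WithLp.ofLp x ⬝ᵥ ((M - lamMin M • (1 : Matrix ι ι ℝ)) *ᵥ WithLp.ofLp x) := by
    rw [inner_act]
    simp only [dotProduct, Matrix.mulVec, Finset.mul_sum]
    refine Finset.sum_congr rfl fun i _ => Finset.sum_congr rfl fun j _ => by ring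
  have h' : 0 ≤ inner ℝ x (act (M - lamMin M • (1 : Matrix ι ι ℝ)) x) := by
    rw [e]; simpa using h
  rw [sub_act, smul_act, one_act, inner_sub_right, inner_smul_right,
    real_inner_self_eq_norm_sq] at h'
  linarith

/-- The inverse of a perturbation of the identity. -/
theorem isUnit_one_sub_and_norm_inv_le [DecidableEq ι] {G : Matrix ι ι ℝ} {c : ℝ} (hc : c < 1)
    (hG : ‖G‖ ≤ c) : IsUnit (1 - G).det ∧ ∀ x, ‖act (1 - G)⁻¹ x‖ ≤ (1 - c)⁻¹ * ‖x‖ := by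
  have hu : IsUnit (1 - G) := isUnit_one_sub_of_norm_lt_one (hG.trans_lt hc)
  have hd := (Matrix.isUnit_iff_isUnit_det _).1 hu
  refine ⟨hd, fun x => ?_⟩
  -- The vector y = (1 − G)⁻¹x solves y = x + Gy, whence ‖y‖ ≤ ‖x‖ + c‖y‖.
  have h1 : act (1 - G)⁻¹ x = x + act G (act (1 - G)⁻¹ x) := by
    have := congrArg (fun M => act M x) (Matrix.mul_nonsing_inv _ hd)
    simp only [mul_act, sub_act, one_act] at this
    rw [sub_eq_iff_eq_add] at this
    exact this
  have h2 : ‖act (1 - G)⁻¹ x‖ ≤ ‖x‖ + c * ‖act (1 - G)⁻¹ x‖ := by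
    calc ‖act (1 - G)⁻¹ x‖ = ‖x + act G (act (1 - G)⁻¹ x)‖ := by rw [← h1]
      _ ≤ ‖x‖ + ‖act G (act (1 - G)⁻¹ x)‖ := norm_add_le _ _
      _ ≤ ‖x‖ + ‖G‖ * ‖act (1 - G)⁻¹ x‖ := by gcongr; exact norm_act_le _ _
      _ ≤ _ := by gcongr
  rw [inv_mul_eq_div, le_div_iff₀ (by linarith)]
  linarith

theorem opNorm_le_of_forall_act_le [Fintype κ] [DecidableEq ι] (M : Matrix κ ι ℝ) {c : ℝ} (hc : 0 ≤ c)
    (h : ∀ x, ‖act M x‖ ≤ c * ‖x‖) : ‖M‖ ≤ c :=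
  opNorm_le_of_act M hc fun x => pow_le_pow_left₀ (norm_nonneg _) (h x) 2

theorem norm_transpose_eq [Fintype κ] [DecidableEq ι] [DecidableEq κ] (M : Matrix κ ι ℝ) : ‖Mᵀ‖ = ‖M‖ := by
  rw [← Matrix.conjTranspose_eq_transpose_of_trivial, Matrix.l2_opNorm_conjTranspose]

end MatrixAction

/-! ### Operator norms of Kronecker products with the identity. -/

section Blocks

variable {N n : ℕ}

/-- The identity factor lets B act on each coordinate c separately; Cauchy–Schwarz on each of the N
rows, of squared length at most Nβ², gives the Frobenius bound. -/
theorem norm_kronecker_one_le {B : Matrix (Fin N) (Fin N) ℝ} {β : ℝ} (hβ : 0 ≤ β)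
    (hB : ∀ i j, |B i j| ≤ β) : ‖B ⊗ₖ (1 : Matrix (Fin n) (Fin n) ℝ)‖ ≤ N * β := by
  refine opNorm_le_of_act _ (by positivity) fun x => ?_
  have h1 : ∀ i c, act (B ⊗ₖ (1 : Matrix (Fin n) (Fin n) ℝ)) x (i, c) = ∑ j, B i j * x (j, c) := by
    intro i c
    rw [act_apply, Fintype.sum_prod_type]
    refine Finset.sum_congr rfl fun j _ => ?_
    simp [Matrix.kroneckerMap_apply, Matrix.one_apply]
  rw [EuclideanSpace.norm_sq_eq, mul_pow, EuclideanSpace.norm_sq_eq, Fintype.sum_prod_type]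
  simp only [h1, Real.norm_eq_abs, sq_abs]
  have h2 : ∀ i c, (∑ j, B i j * x (j, c)) ^ 2 ≤ (N * β ^ 2) * ∑ j, x (j, c) ^ 2 := by
    intro i c
    refine (Finset.sum_mul_sq_le_sq_mul_sq _ _ _).trans ?_
    refine mul_le_mul_of_nonneg_right ?_ (Finset.sum_nonneg fun _ _ => sq_nonneg _)
    calc ∑ j, B i j ^ 2 ≤ ∑ _j : Fin N, β ^ 2 :=
          Finset.sum_le_sum fun j _ => sq_le_sq' (abs_le.1 (hB i j)).1 (abs_le.1 (hB i j)).2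
      _ = N * β ^ 2 := by simp
  calc ∑ i, ∑ c, (∑ j, B i j * x (j, c)) ^ 2
      ≤ ∑ _i : Fin N, ∑ c, (N * β ^ 2) * ∑ j, x (j, c) ^ 2 :=
        Finset.sum_le_sum fun i _ => Finset.sum_le_sum fun c _ => h2 i c
    _ = (N * β) ^ 2 * ∑ x_1 : Fin N × Fin n, x x_1 ^ 2 := by
        rw [Finset.sum_const, ← Finset.mul_sum, Finset.sum_comm, Fintype.sum_prod_type]
        simp only [Finset.card_univ, Fintype.card_fin, nsmul_eq_mul]
        ring

theorem norm_diagonal_kronecker_one_le {D : Fin N → ℝ} {β : ℝ} (hβ : 0 ≤ β)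
    (hD : ∀ i, |D i| ≤ β) :
    ‖Matrix.diagonal D ⊗ₖ (1 : Matrix (Fin n) (Fin n) ℝ)‖ ≤ β := by
  rw [← Matrix.diagonal_one, Matrix.diagonal_kronecker_diagonal, Matrix.l2_opNorm_diagonal]
  refine (pi_norm_le_iff_of_nonneg hβ).2 fun i => ?_
  simpa using hD i.1

end Blocks

/-! ### Measurability of random matrices with respect to a sub-sigma-field. -/

section Measurability

variable {Ω ι κ l : Type*} {m : MeasurableSpace Ω}

/-- Entrywise measurability of a random matrix. -/
def MeasMat (m : MeasurableSpace Ω) (M : Ω → Matrix κ ι ℝ) : Prop :=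
  ∀ i j, Measurable[m] fun ω => M ω i j

theorem MeasMat.mono {m' : MeasurableSpace Ω} (hm : m ≤ m') {M : Ω → Matrix κ ι ℝ}
    (h : MeasMat m M) : MeasMat m' M := fun i j => (h i j).mono hm le_rfl

theorem MeasMat.const (M : Matrix κ ι ℝ) : MeasMat m fun _ => M := fun _ _ => measurable_const

theorem MeasMat.add {M M' : Ω → Matrix κ ι ℝ} (h : MeasMat m M) (h' : MeasMat m M') :
    MeasMat m fun ω => M ω + M' ω := fun i j => (h i j).add (h' i j)

theorem MeasMat.sub {M M' : Ω → Matrix κ ι ℝ} (h : MeasMat m M) (h' : MeasMat m M') :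
    MeasMat m fun ω => M ω - M' ω := fun i j => (h i j).sub (h' i j)

theorem MeasMat.smul {M : Ω → Matrix κ ι ℝ} (c : ℝ) (h : MeasMat m M) :
    MeasMat m fun ω => c • M ω := fun i j => (h i j).const_mul c

theorem MeasMat.transpose {M : Ω → Matrix κ ι ℝ} (h : MeasMat m M) :
    MeasMat m fun ω => (M ω)ᵀ := fun i j => h j i

theorem MeasMat.mul [Fintype ι] {M : Ω → Matrix κ ι ℝ} {M' : Ω → Matrix ι l ℝ}
    (h : MeasMat m M) (h' : MeasMat m M') : MeasMat m fun ω => M ω * M' ω := by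
  intro i j
  simp only [Matrix.mul_apply]
  exact Finset.measurable_sum _ fun r _ => (h i r).mul (h' r j)

theorem MeasMat.sum {α : Type*} (s : Finset α) {M : α → Ω → Matrix κ ι ℝ}
    (h : ∀ a ∈ s, MeasMat m (M a)) : MeasMat m fun ω => ∑ a ∈ s, M a ω := by
  intro i j
  simp only [Matrix.sum_apply]
  exact Finset.measurable_sum _ fun a ha => h a ha i j

theorem MeasMat.kronecker_one [DecidableEq l] {M : Ω → Matrix κ ι ℝ} (h : MeasMat m M) :
    MeasMat m fun ω => M ω ⊗ₖ (1 : Matrix l l ℝ) := by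
  intro i j
  simp only [Matrix.kroneckerMap_apply]
  exact (h _ _).mul_const _

theorem MeasMat.det [Fintype ι] [DecidableEq ι] {M : Ω → Matrix ι ι ℝ} (h : MeasMat m M) :
    Measurable[m] fun ω => (M ω).det := by
  simp only [Matrix.det_apply]
  exact Finset.measurable_sum _ fun σ _ =>
    (Finset.measurable_prod _ fun i _ => h _ _).const_smul _

/-- The adjugate formula holds for singular matrices too, with the default value 0 for the inverse
of the determinant, so invertibility is not needed. -/
theorem MeasMat.inv [Fintype ι] [DecidableEq ι] {M : Ω → Matrix ι ι ℝ} (h : MeasMat m M) :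
    MeasMat m fun ω => (M ω)⁻¹ := by
  intro i j
  simp only [Matrix.inv_def, Matrix.smul_apply, Ring.inverse_eq_inv', Matrix.adjugate_apply,
    smul_eq_mul]
  refine h.det.inv.mul (MeasMat.det fun r c => ?_)
  by_cases hr : r = j
  · simp [hr]
  · simpa [Matrix.updateRow_ne hr] using h r c

theorem MeasMat.transProd [Fintype ι] [DecidableEq ι] {Z : Ω → ℤ → Matrix ι ι ℝ} {j i : ℤ}
    (h : ∀ t ≤ j, MeasMat m fun ω => Z ω t) : MeasMat m fun ω => transProd (Z ω) j i := by
  unfold CoopEst.transProd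
  generalize (j + 1 - i).toNat = q
  induction q with
  | zero => simpa using MeasMat.const 1
  | succ q ih =>
    simp only [List.range_succ, List.map_append, List.prod_append, List.map_cons, List.map_nil,
      List.prod_singleton]
    exact ih.mul (h _ (by omega))

theorem MeasMat.act [Fintype ι] [Fintype κ] {M : Ω → Matrix κ ι ℝ} (h : MeasMat m M)
    {x : Ω → EuclideanSpace ℝ ι} (hx : Measurable[m] x) : Measurable[m] fun ω => act (M ω) (x ω) := by
  refine (WithLp.measurable_toLp 2 _).comp (measurable_pi_lambda _ fun i => ?_)
  exact Finset.measurable_sum _ fun j _ => (h i j).mul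
    ((measurable_pi_apply j).comp ((WithLp.measurable_ofLp 2 _).comp hx))

end Measurability

/-- One more factor on the right of a transition product. -/
theorem transProd_succ {R : Type*} [Monoid R] (Z : ℤ → R) (k : ℤ) (q : ℕ) :
    transProd Z (k - 1) (k - (q + 1 : ℕ)) = transProd Z (k - 1) (k - q) * Z (k - (q + 1 : ℕ)) := by
  unfold transProd
  have e1 : (k - 1 + 1 - (k - (q + 1 : ℕ))).toNat = q + 1 := by omega
  have e2 : (k - 1 + 1 - (k - q)).toNat = q := by omega
  rw [e1, e2, List.range_succ, List.map_append, List.prod_append, List.map_singleton,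
    List.prod_singleton]
  congr 2
  push_cast
  ring

/-- The smallness condition on one value of the gain, freed of quotients. -/
theorem mul_le_of_lt_min_quotients {N d : ℕ} (hN : 0 < N) {βa βH Ca κ b : ℝ} (hβ : 0 < βa)
    (hCa : 0 ≤ Ca) (hκ0 : 0 < κ) (hκ1 : κ < 1)
    (hb : b < min (κ / (2 * (N * βa + N * √N * βa + Ca * βH ^ 2)))
        ((1 - (1 - κ)⁻¹) * κ /
          (2 * N * √N * βa * (1 - (1 - κ) ^ (-((d : ℤ) + 1)))))) :
    b * (N * βa + Ca * βH ^ 2) ≤ κ / 2 - b * (N * √N * βa) ∧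
      b * (N * √N * βa * ∑ q ∈ Finset.range (d + 1), ((1 - κ)⁻¹) ^ q) ≤ κ / 2 := by
  have hN' : (0 : ℝ) < N := by exact_mod_cast hN
  have hs : 0 < √(N : ℝ) := Real.sqrt_pos.2 hN'
  obtain ⟨h1, h2⟩ := lt_min_iff.1 hb
  have hρ : 1 < (1 - κ)⁻¹ := (one_lt_inv₀ (by linarith)).2 (by linarith)
  set ρ := (1 - κ)⁻¹ with hρd
  have hz : (1 - κ) ^ (-((d : ℤ) + 1)) = ρ ^ (d + 1) := by
    rw [zpow_neg, hρd, inv_pow]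
    congr 1
  have hg : (∑ q ∈ Finset.range (d + 1), ρ ^ q) * (ρ - 1) = ρ ^ (d + 1) - 1 := geom_sum_mul ρ (d + 1)
  have hsum : 0 < ∑ q ∈ Finset.range (d + 1), ρ ^ q :=
    Finset.sum_pos (fun q _ => by positivity) (by simp)
  constructor
  · rw [lt_div_iff₀ (by positivity)] at h1
    linarith
  · rw [hz] at h2
    -- Here ρ > 1, so both 1 − ρ and 1 − ρ^(d+1) are negative; their quotient is the reciprocal of
    -- the geometric sum.
    have e : (1 - ρ) * κ / (2 * N * √N * βa * (1 - ρ ^ (d + 1)))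
        = κ / (2 * N * √N * βa * ∑ q ∈ Finset.range (d + 1), ρ ^ q) := by
      have e1 : 1 - ρ ^ (d + 1) = (∑ q ∈ Finset.range (d + 1), ρ ^ q) * (1 - ρ) := by linarith
      have hρ1 : 1 - ρ ≠ 0 := by linarith
      rw [e1]
      field_simp
    rw [e, lt_div_iff₀ (by positivity)] at h2
    linarith

/-! ### Pathwise analysis: the error recursion, invertibility of F, and the defect caused by delays.
-/

namespace Network

variable {Ω : Type*} [MeasurableSpace Ω] {μ : Measure Ω} {N n d : ℕ} {p : Fin N → ℕ}
  (S : Network μ N n d p)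

/-- The stacked estimation error. -/
noncomputable def err (ω : Ω) (t : ℤ) : EuclideanSpace ℝ (Fin N × Fin n) :=
  WithLp.toLp 2 fun c => S.estimate ω t c.1 c.2 - S.x₀ c.2

theorem err_apply (ω : Ω) (t : ℤ) (i : Fin N) (c : Fin n) :
    S.err ω t (i, c) = S.estimate ω t i c - S.x₀ c := rfl

/-- The noise seen through the observation matrices. -/
noncomputable def obsNoise (k : ℕ) (ω : Ω) : EuclideanSpace ℝ (Fin N × Fin n) :=
  act (S.Hdiag k ω)ᵀ (S.v k ω)

/-- The defect of the delay-free recursion. -/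
noncomputable def res (ω : Ω) (t : ℤ) : EuclideanSpace ℝ (Fin N × Fin n) :=
  S.err ω (t + 1) - act (S.F ω t) (S.err ω t)

theorem act_Hdiag_apply (k : ℕ) (ω : Ω) (x : EuclideanSpace ℝ (Fin N × Fin n)) (i : Fin N)
    (r : Fin (p i)) :
    act (S.Hdiag k ω) x ⟨i, r⟩ = ∑ c, S.H k i ω r c * x (i, c) := by
  rw [act_apply, Fintype.sum_prod_type, Finset.sum_eq_single i]
  · simp [Hdiag]
  · intro j _ hj
    refine Finset.sum_eq_zero fun c _ => ?_
    simp [Hdiag, Ne.symm hj]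
  · simp

theorem act_Hdiag_transpose_apply (k : ℕ) (ω : Ω)
    (y : EuclideanSpace ℝ (Σ i : Fin N, Fin (p i))) (i : Fin N) (c : Fin n) :
    act (S.Hdiag k ω)ᵀ y (i, c) = ∑ r, S.H k i ω r c * y ⟨i, r⟩ := by
  rw [act_apply, Fintype.sum_sigma, Finset.sum_eq_single i]
  · simp [Hdiag]
  · intro j _ hj
    refine Finset.sum_eq_zero fun c _ => ?_
    simp [Hdiag, hj]
  · simp

theorem act_degMat_apply (k : ℕ) (ω : Ω) (x : EuclideanSpace ℝ (Fin N × Fin n)) (i : Fin N)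
    (c : Fin n) :
    act (S.degMat k ω ⊗ₖ (1 : Matrix (Fin n) (Fin n) ℝ)) x (i, c)
      = (∑ j, S.adj k ω i j) * x (i, c) := by
  rw [act_apply, degMat, ← Matrix.diagonal_one, Matrix.diagonal_kronecker_diagonal,
    Finset.sum_eq_single (i, c)]
  · simp
  · intro j _ hj
    simp [Matrix.diagonal_apply_ne _ (Ne.symm hj)]
  · simp

theorem act_Abar_apply (k q : ℕ) (ω : Ω) (x : EuclideanSpace ℝ (Fin N × Fin n)) (i : Fin N)
    (c : Fin n) :
    act (S.Abar k q ω) x (i, c)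
      = ∑ j, S.adj k ω i j * (if (S.delay k j i ω : ℕ) = q then x (j, c) else 0) := by
  rw [act_apply, Fintype.sum_prod_type]
  refine Finset.sum_congr rfl fun j _ => ?_
  rw [Finset.sum_eq_single c]
  · simp only [Abar, Matrix.kroneckerMap_apply, Matrix.hadamard_apply, delayMat, Matrix.of_apply,
      Matrix.one_apply_eq, mul_one]
    split_ifs <;> simp
  · intro c' _ hc
    simp [Abar, Matrix.kroneckerMap_apply, Matrix.one_apply_ne (Ne.symm hc)]
  · simp

/-- The compact form of the error recursion. -/
theorem err_succ (ω : Ω) (k : ℕ) :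
    S.err ω (k + 1) = S.err ω k - S.b k • act (S.degMat k ω ⊗ₖ (1 : Matrix (Fin n) (Fin n) ℝ))
        (S.err ω k) - S.a k • act ((S.Hdiag k ω)ᵀ * S.Hdiag k ω) (S.err ω k)
      + S.a k • S.obsNoise k ω
      + S.b k • ∑ q ∈ Finset.range (d + 1), act (S.Abar k q ω) (S.err ω ((k : ℤ) - q)) := by
  ext ⟨i, c⟩
  have hfilter : (∑ j ∈ Finset.univ.filter (fun j => S.adj k ω i j ≠ 0),
        S.adj k ω i j • (S.estimate ω ((k : ℤ) - ((S.delay k j i ω : ℕ) : ℤ)) j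
          - S.estimate ω k i)) c
      = ∑ j, S.adj k ω i j * (S.err ω ((k : ℤ) - ((S.delay k j i ω : ℕ) : ℤ)) (j, c)
          - S.err ω k (i, c)) := by
    rw [WithLp.ofLp_sum, Finset.sum_apply, Finset.sum_filter]
    refine Finset.sum_congr rfl fun j _ => ?_
    by_cases h : S.adj k ω i j = 0
    · simp [h]
    · simp [h, err_apply]
  have hdelay : (∑ q ∈ Finset.range (d + 1), act (S.Abar k q ω) (S.err ω ((k : ℤ) - q))) (i, c)
      = ∑ j, S.adj k ω i j * S.err ω ((k : ℤ) - ((S.delay k j i ω : ℕ) : ℤ)) (j, c) := by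
    rw [WithLp.ofLp_sum, Finset.sum_apply]
    simp only [act_Abar_apply]
    rw [Finset.sum_comm]
    refine Finset.sum_congr rfl fun j _ => ?_
    rw [← Finset.mul_sum]
    congr 1
    rw [Finset.sum_eq_single (S.delay k j i ω : ℕ)]
    · simp
    · intro q _ hq
      simp [Ne.symm hq]
    · intro hq
      exact absurd (Finset.mem_range.2 (S.delay k j i ω).isLt) hq
  have hobs : (Matrix.toEuclideanLin (S.H k i ω)ᵀ
        (S.meas k i ω - Matrix.toEuclideanLin (S.H k i ω) (S.estimate ω k i))) c
      = S.obsNoise k ω (i, c) - act ((S.Hdiag k ω)ᵀ * S.Hdiag k ω) (S.err ω k) (i, c) := by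
    rw [mul_act, act_Hdiag_transpose_apply, obsNoise, act_Hdiag_transpose_apply,
      ← Finset.sum_sub_distrib]
    change ∑ r, (S.H k i ω)ᵀ c r * _ = _
    refine Finset.sum_congr rfl fun r _ => ?_
    rw [act_Hdiag_apply, Matrix.transpose_apply, ← mul_sub]
    congr 1
    change (∑ c, S.H k i ω r c * S.x₀ c + S.v k ω ⟨i, r⟩)
      - ∑ c, S.H k i ω r c * S.estimate ω k i c = _
    simp only [err_apply, mul_sub, Finset.sum_sub_distrib]
    ring
  have h0 := congrArg (fun x : EuclideanSpace ℝ (Fin n) => x c) (S.estimate_succ ω k i)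
  simp only [algStep, PiLp.add_apply, PiLp.smul_apply, smul_eq_mul, hfilter, hobs] at h0
  simp only [PiLp.add_apply, PiLp.sub_apply, PiLp.smul_apply, smul_eq_mul, hdelay]
  rw [err_apply, h0, act_degMat_apply]
  simp only [mul_sub, Finset.sum_sub_distrib, ← Finset.sum_mul]
  simp only [err_apply]
  ring

/-- Up to the observed noise, the defect only comes from delayed data. -/
theorem res_natCast (ω : Ω) (k : ℕ) :
    S.res ω k = S.a k • S.obsNoise k ω + S.b k • ∑ q ∈ Finset.range (d + 1),
      act (S.Abar k q ω) (S.err ω ((k : ℤ) - q)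
        - act (transProd (S.F ω) ((k : ℤ) - 1) ((k : ℤ) - q))⁻¹ (S.err ω k)) := by
  rw [res, err_succ, F_natCast, Gmat]
  simp only [sub_act, add_act, smul_act, one_act, sum_act, act_sub, Finset.sum_sub_distrib,
    mul_act, smul_sub]
  abel

theorem err_succ_eq (ω : Ω) (k : ℕ) :
    S.err ω (k + 1) = S.err ω k - act (S.Gmat k ω (S.F ω)) (S.err ω k) + S.res ω k := by
  rw [res, F_natCast, sub_act, one_act]
  abel

theorem norm_Hdiag_le {βH : ℝ} (hβ : 0 ≤ βH) {k : ℕ} {ω : Ω} (h : ∀ i, ‖S.H k i ω‖ ≤ βH) :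
    ‖S.Hdiag k ω‖ ≤ βH := by
  refine opNorm_le_of_act _ hβ fun x => ?_
  rw [EuclideanSpace.norm_sq_eq, mul_pow, EuclideanSpace.norm_sq_eq, Fintype.sum_prod_type,
    Fintype.sum_sigma, Finset.mul_sum]
  refine Finset.sum_le_sum fun i _ => ?_
  have h1 := norm_act_le (S.H k i ω) (WithLp.toLp 2 fun c => x (i, c))
  have h2 : ‖act (S.H k i ω) (WithLp.toLp 2 fun c => x (i, c))‖ ^ 2
      ≤ (βH * ‖(WithLp.toLp 2 fun c => x (i, c) : EuclideanSpace ℝ (Fin n))‖) ^ 2 := by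
    refine pow_le_pow_left₀ (norm_nonneg _) (h1.trans ?_) 2
    gcongr
    exact h i
  rw [mul_pow, EuclideanSpace.norm_sq_eq, EuclideanSpace.norm_sq_eq] at h2
  simp only [act_Hdiag_apply]
  simpa only [act_apply] using h2

theorem norm_Abar_le {βa : ℝ} (hβ : 0 ≤ βa) {k : ℕ} {ω : Ω} (h : ∀ i j, |S.adj k ω i j| ≤ βa)
    (q : ℕ) : ‖S.Abar k q ω‖ ≤ N * βa := by
  refine norm_kronecker_one_le hβ fun i j => ?_
  simp only [Matrix.hadamard_apply, delayMat, Matrix.of_apply]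
  split_ifs
  · simpa using h i j
  · simpa using hβ

theorem norm_degMat_kronecker_le {βa : ℝ} (hβ : 0 ≤ βa) {k : ℕ} {ω : Ω}
    (h : ∀ i j, |S.adj k ω i j| ≤ βa) :
    ‖S.degMat k ω ⊗ₖ (1 : Matrix (Fin n) (Fin n) ℝ)‖ ≤ N * βa := by
  refine norm_diagonal_kronecker_one_le (by positivity) fun i => ?_
  refine (Finset.abs_sum_le_sum_abs _ _).trans ?_
  calc ∑ j, |S.adj k ω i j| ≤ ∑ _j : Fin N, βa := Finset.sum_le_sum fun j _ => h i j
    _ = N * βa := by simp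

/-- Inverses of transition products, from inverses of the factors. -/
theorem norm_act_transProd_inv_le {ω : Ω} {k : ℤ} {ρ : ℝ} (hρ : 0 ≤ ρ)
    (h : ∀ t < k, ∀ x, ‖act (S.F ω t)⁻¹ x‖ ≤ ρ * ‖x‖) (q : ℕ)
    (x : EuclideanSpace ℝ (Fin N × Fin n)) :
    ‖act (transProd (S.F ω) (k - 1) (k - q))⁻¹ x‖ ≤ ρ ^ q * ‖x‖ := by
  induction q with
  | zero => simp [transProd, one_act]
  | succ q ih =>
    rw [transProd_succ, Matrix.mul_inv_rev, mul_act, pow_succ']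
    calc _ ≤ ρ * ‖act (transProd (S.F ω) (k - 1) (k - q))⁻¹ x‖ := h _ (by omega) _
      _ ≤ ρ * (ρ ^ q * ‖x‖) := by gcongr
      _ = _ := by ring

theorem norm_transProd_inv_le {ω : Ω} {k : ℤ} {ρ : ℝ} (hρ : 0 ≤ ρ)
    (h : ∀ t < k, ∀ x, ‖act (S.F ω t)⁻¹ x‖ ≤ ρ * ‖x‖) (q : ℕ) :
    ‖(transProd (S.F ω) (k - 1) (k - q))⁻¹‖ ≤ ρ ^ q :=
  opNorm_le_of_forall_act_le _ (by positivity) (S.norm_act_transProd_inv_le hρ h q)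

theorem norm_obs_gram_le {βH : ℝ} (hβ : 0 ≤ βH) {k : ℕ} {ω : Ω} (h : ∀ i, ‖S.H k i ω‖ ≤ βH) :
    ‖(S.Hdiag k ω)ᵀ * S.Hdiag k ω‖ ≤ βH ^ 2 := by
  have h1 := S.norm_Hdiag_le hβ h
  rw [← Matrix.conjTranspose_eq_transpose_of_trivial, Matrix.l2_opNorm_conjTranspose_mul_self, sq]
  gcongr

/-- Inverses are controlled only at times before k, so the bound can serve as the step of the
induction that proves invertibility. The sum over q becomes the geometric sum that appears in the
gain condition. -/
theorem norm_Gmat_le {ω : Ω} {k : ℕ} {ρ βa βH : ℝ} (hρ : 0 ≤ ρ) (hβa : 0 ≤ βa) (hβH : 0 ≤ βH)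
    (ha : 0 ≤ S.a k) (hb : 0 ≤ S.b k)
    (hA : ∀ i j, |S.adj k ω i j| ≤ βa) (hH : ∀ i, ‖S.H k i ω‖ ≤ βH)
    (h : ∀ t < (k : ℤ), ∀ x, ‖act (S.F ω t)⁻¹ x‖ ≤ ρ * ‖x‖) :
    ‖S.Gmat k ω (S.F ω)‖ ≤ S.b k * (N * βa) + S.a k * βH ^ 2
      + S.b k * (N * βa * ∑ q ∈ Finset.range (d + 1), ρ ^ q) := by
  rw [Gmat]
  refine (norm_sub_le _ _).trans (add_le_add ((norm_add_le _ _).trans (add_le_add ?_ ?_)) ?_)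
  · rw [norm_smul, Real.norm_eq_abs, abs_of_nonneg hb]
    gcongr
    exact S.norm_degMat_kronecker_le hβa hA
  · rw [norm_smul, Real.norm_eq_abs, abs_of_nonneg ha]
    gcongr
    exact S.norm_obs_gram_le hβH hH
  · rw [norm_smul, Real.norm_eq_abs, abs_of_nonneg hb, Finset.mul_sum]
    gcongr
    refine (norm_sum_le _ _).trans (Finset.sum_le_sum fun q _ => ?_)
    refine (Matrix.l2_opNorm_mul _ _).trans ?_
    gcongr
    · exact S.norm_Abar_le hβa hA q
    · exact S.norm_transProd_inv_le hρ h q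

/-- Uniform invertibility of the transition matrices on a single trajectory. -/
theorem isUnit_F_and_norm_inv_le {ω : Ω} {κ βa βH Ca : ℝ} (hN : 0 < N)
    (hκ1 : κ < 1) (hκ0 : 0 < κ) (hβa : 0 < βa) (hβH : 0 ≤ βH)
    (ha : ∀ k, 0 < S.a k) (hb : ∀ k, 0 < S.b k) (hab : ∀ k, S.a k ≤ Ca * S.b k)
    (hA : ∀ k i j, |S.adj k ω i j| ≤ βa) (hH : ∀ k i, ‖S.H k i ω‖ ≤ βH)
    (hsmall : ∀ k, S.b k < min (κ / (2 * (N * βa + N * √N * βa + Ca * βH ^ 2)))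
        ((1 - (1 - κ)⁻¹) * κ /
          (2 * N * √N * βa * (1 - (1 - κ) ^ (-((d : ℤ) + 1)))))) (t : ℤ) :
    IsUnit (S.F ω t).det ∧ ∀ x, ‖act (S.F ω t)⁻¹ x‖ ≤ (1 - κ)⁻¹ * ‖x‖ := by
  have hρ1 : 1 ≤ (1 - κ)⁻¹ := (one_le_inv₀ (by linarith)).2 (by linarith)
  have hneg : ∀ t < (0 : ℤ), IsUnit (S.F ω t).det ∧ ∀ x, ‖act (S.F ω t)⁻¹ x‖ ≤ (1 - κ)⁻¹ * ‖x‖ := by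
    intro t ht
    rw [F_of_neg _ _ ht]
    refine ⟨by simp, fun x => ?_⟩
    rw [inv_one, one_act]
    exact le_mul_of_one_le_left (norm_nonneg _) hρ1
  have hpos : ∀ k : ℕ, IsUnit (S.F ω k).det ∧ ∀ x, ‖act (S.F ω k)⁻¹ x‖ ≤ (1 - κ)⁻¹ * ‖x‖ := by
    intro k
    induction k using Nat.strong_induction_on with
    | _ k ih =>
      rw [F_natCast]
      refine isUnit_one_sub_and_norm_inv_le hκ1 ?_
      have hCa : 0 ≤ Ca := by
        have h1 := (ha 0).trans_le (hab 0)
        exact (pos_of_mul_pos_left h1 (hb 0).le).le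
      obtain ⟨h1, h2⟩ := mul_le_of_lt_min_quotients hN hβa hCa hκ0 hκ1 (hsmall k)
      refine (S.norm_Gmat_le (ρ := (1 - κ)⁻¹) (by positivity) hβa.le hβH (ha k).le (hb k).le
        (hA k) (hH k) ?_).trans ?_
      · intro t ht
        rcases lt_or_ge t 0 with h0 | h0
        · exact (hneg t h0).2
        · lift t to ℕ using h0
          exact (ih t (by exact_mod_cast ht)).2
      -- The operator norms cost Nβa while the gain condition offers N√Nβa, which is larger since N
      -- ≥ 1. Its two halves κ/2 then add up to κ.
      · have hs1 : 1 ≤ √(N : ℝ) := Real.one_le_sqrt.2 (by exact_mod_cast hN)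
        have hsum : 0 ≤ ∑ q ∈ Finset.range (d + 1), ((1 - κ)⁻¹) ^ q :=
          Finset.sum_nonneg fun q _ => by positivity
        have h3 : S.a k * βH ^ 2 ≤ S.b k * (Ca * βH ^ 2) := by
          nlinarith [mul_le_mul_of_nonneg_right (hab k) (sq_nonneg βH)]
        have h4 : S.b k * (N * βa * ∑ q ∈ Finset.range (d + 1), ((1 - κ)⁻¹) ^ q)
            ≤ S.b k * (N * √N * βa * ∑ q ∈ Finset.range (d + 1), ((1 - κ)⁻¹) ^ q) := by
          have := (hb k).le
          gcongr
          exact le_mul_of_one_le_right (by positivity) hs1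
        have h5 : 0 ≤ S.b k * (N * √N * βa) := mul_nonneg (hb k).le (by positivity)
        linarith
  rcases lt_or_ge t 0 with h0 | h0
  · exact hneg t h0
  · lift t to ℕ using h0
    exact hpos t

/-- Going back `q` steps with the inverse transition matrices. -/
theorem norm_err_sub_le {ω : Ω} {ρ : ℝ} (hρ : 1 ≤ ρ)
    (hF : ∀ t, IsUnit (S.F ω t).det ∧ ∀ x, ‖act (S.F ω t)⁻¹ x‖ ≤ ρ * ‖x‖) (k : ℤ) (q : ℕ) :
    ‖S.err ω (k - q) - act (transProd (S.F ω) (k - 1) (k - q))⁻¹ (S.err ω k)‖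
      ≤ ρ ^ q * ∑ i ∈ Finset.range q, ‖S.res ω (k - (i + 1 : ℕ))‖ := by
  induction q with
  | zero => simp [transProd, one_act]
  | succ q ih =>
    set t : ℤ := k - (q + 1 : ℕ) with ht
    -- Solving e(t+1) = F(t)e(t) + r(t) for e(t) produces one more inverse factor and one more
    -- defect.
    have e : S.err ω t = act (S.F ω t)⁻¹ (S.err ω (k - q) - S.res ω t) := by
      have h1 : S.err ω (k - q) - S.res ω t = act (S.F ω t) (S.err ω t) := by
        rw [res, show t + 1 = k - q by omega]
        abel
      rw [h1, ← mul_act, Matrix.nonsing_inv_mul _ (hF t).1, one_act]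
    rw [transProd_succ, Matrix.mul_inv_rev, mul_act, ← ht, e, ← act_sub]
    have hsum : 0 ≤ ∑ i ∈ Finset.range q, ‖S.res ω (k - (i + 1 : ℕ))‖ :=
      Finset.sum_nonneg fun _ _ => norm_nonneg _
    calc _ ≤ ρ * ‖S.err ω (k - q) - S.res ω t
            - act (transProd (S.F ω) (k - 1) (k - q))⁻¹ (S.err ω k)‖ := (hF t).2 _
      _ = ρ * ‖(S.err ω (k - q) - act (transProd (S.F ω) (k - 1) (k - q))⁻¹ (S.err ω k))
            - S.res ω t‖ := by congr 2; abel
      _ ≤ ρ * (ρ ^ q * ∑ i ∈ Finset.range q, ‖S.res ω (k - (i + 1 : ℕ))‖ + ‖S.res ω t‖) := by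
          gcongr
          exact (norm_sub_le _ _).trans (add_le_add_left ih _)
      _ ≤ ρ * (ρ ^ q * ∑ i ∈ Finset.range q, ‖S.res ω (k - (i + 1 : ℕ))‖
            + ρ ^ q * ‖S.res ω t‖) := by
          gcongr
          exact le_mul_of_one_le_left (norm_nonneg _) (one_le_pow₀ hρ)
      _ = _ := by rw [Finset.sum_range_succ, ← ht]; ring

/-- The part of the defect that is due to the delays. -/
noncomputable def delayRes (ω : Ω) (k : ℕ) : EuclideanSpace ℝ (Fin N × Fin n) :=
  S.res ω k - S.a k • S.obsNoise k ω

/-- Without the noise only the brackets e(k−q) − [Φ_F]⁻¹e(k) remain, and each is controlled by at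
most d earlier defects. The errors themselves drop out, so this is a closed recursion for the
defect. -/
theorem norm_delayRes_le {ω : Ω} {ρ βa : ℝ} (hρ : 1 ≤ ρ) (hβa : 0 ≤ βa) {k : ℕ}
    (hb : 0 ≤ S.b k) (hA : ∀ i j, |S.adj k ω i j| ≤ βa)
    (hF : ∀ t, IsUnit (S.F ω t).det ∧ ∀ x, ‖act (S.F ω t)⁻¹ x‖ ≤ ρ * ‖x‖) :
    ‖S.delayRes ω k‖ ≤ (d + 1) * (N * βa) * ρ ^ d * S.b k *
      ∑ i ∈ Finset.range d, ‖S.res ω ((k : ℤ) - (i + 1 : ℕ))‖ := by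
  rw [delayRes, res_natCast, add_sub_cancel_left, norm_smul, Real.norm_eq_abs, abs_of_nonneg hb]
  have h1 : ∀ q ∈ Finset.range (d + 1), ‖act (S.Abar k q ω) (S.err ω ((k : ℤ) - q)
        - act (transProd (S.F ω) ((k : ℤ) - 1) ((k : ℤ) - q))⁻¹ (S.err ω k))‖
      ≤ N * βa * (ρ ^ d * ∑ i ∈ Finset.range d, ‖S.res ω ((k : ℤ) - (i + 1 : ℕ))‖) := by
    intro q hq
    have hq' : q ≤ d := by simpa [Nat.lt_succ_iff] using hq
    refine (norm_act_le _ _).trans ?_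
    gcongr
    · exact S.norm_Abar_le hβa hA q
    · refine (S.norm_err_sub_le hρ hF k q).trans ?_
      gcongr
  calc _ ≤ S.b k * ∑ q ∈ Finset.range (d + 1),
        (N * βa * (ρ ^ d * ∑ i ∈ Finset.range d, ‖S.res ω ((k : ℤ) - (i + 1 : ℕ))‖)) := by
        gcongr
        exact (norm_sum_le _ _).trans (Finset.sum_le_sum h1)
    _ = _ := by
        rw [Finset.sum_const, Finset.card_range, nsmul_eq_mul]
        push_cast
        ring

end Network
-- Deterministic recursions and gain sequences.
/-- A stochastic-approximation recursion with divergent gains and vanishing perturbation. -/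
theorem tendsto_zero_of_gain_recursion {W α ζ : ℕ → ℝ} (hW : ∀ m, 0 ≤ W m)
    (hα0 : ∀ᶠ m in atTop, 0 ≤ α m) (hα1 : ∀ᶠ m in atTop, α m ≤ 1)
    (hsum : Tendsto (fun M => ∑ m ∈ Finset.range M, α m) atTop atTop)
    (hζ : Tendsto ζ atTop (𝓝 0))
    (hrec : ∀ᶠ m in atTop, W (m + 1) ≤ (1 - α m) * W m + ζ m * α m) :
    Tendsto W atTop (𝓝 0) := by
  rw [Metric.tendsto_atTop]
  intro δ' hδ'
  obtain ⟨δ, hδ, hδδ⟩ : ∃ δ > 0, 2 * δ < δ' := ⟨δ' / 3, by positivity, by linarith⟩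
  obtain ⟨m0, hm0⟩ := eventually_atTop.1 (hα0.and (hα1.and (hrec.and (hζ.eventually_lt_const hδ))))
  have hstep : ∀ j, W (m0 + j) - δ ≤
      Real.exp (-∑ i ∈ Finset.range j, α (m0 + i)) * W m0 := by
    have hpos : ∀ j, 0 ≤ Real.exp (-∑ i ∈ Finset.range j, α (m0 + i)) * W m0 :=
      fun j => mul_nonneg (Real.exp_pos _).le (hW m0)
    intro j
    induction j with
    | zero => simp [hδ.le]
    | succ j ih =>
      obtain ⟨h0, h1, h2, h3⟩ := hm0 (m0 + j) (by omega)
      -- Once ζ ≤ δ, the excess of W over the level δ contracts by 1 − α ≤ exp(−α).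
      have h4 : W (m0 + (j + 1)) - δ ≤ (1 - α (m0 + j)) * (W (m0 + j) - δ) := by
        rw [← add_assoc]
        nlinarith [mul_le_mul_of_nonneg_right h3.le h0]
      refine h4.trans ((mul_le_mul_of_nonneg_left ih (by linarith)).trans ?_)
      rw [Finset.sum_range_succ, neg_add, Real.exp_add, mul_comm (Real.exp _) (Real.exp _),
        mul_assoc]
      refine mul_le_mul_of_nonneg_right ?_ (hpos j)
      linarith [Real.add_one_le_exp (-α (m0 + j))]
  have htail : Tendsto (fun j => ∑ i ∈ Finset.range j, α (m0 + i)) atTop atTop := by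
    have h1 : Tendsto (fun j => ∑ i ∈ Finset.range (m0 + j), α i) atTop atTop :=
      hsum.comp (tendsto_atTop_mono (fun j => Nat.le_add_left j m0) tendsto_id)
    have h2 := tendsto_atTop_add_const_right atTop (-∑ i ∈ Finset.range m0, α i) h1
    refine h2.congr fun j => ?_
    rw [Finset.sum_range_add]
    ring
  have hexp : Tendsto (fun j => Real.exp (-∑ i ∈ Finset.range j, α (m0 + i)) * W m0) atTop
      (𝓝 0) := by
    have := (Real.tendsto_exp_neg_atTop_nhds_zero.comp htail).mul_const (W m0)
    simpa using this
  obtain ⟨j0, hj0⟩ := eventually_atTop.1 (hexp.eventually_lt_const hδ)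
  refine ⟨m0 + j0, fun m hm => ?_⟩
  obtain ⟨j, rfl⟩ := Nat.exists_eq_add_of_le (show m0 ≤ m by omega)
  have h1 := hj0 j (by omega)
  have h2 := hstep j
  rw [Real.dist_eq, sub_zero, abs_of_nonneg (hW _)]
  linarith

/-- The same with a summable perturbation of the contraction factor. -/
theorem tendsto_zero_of_gain_recursion_of_summable {V α ε ζ : ℕ → ℝ} (hV : ∀ m, 0 ≤ V m)
    (hα0 : ∀ m, 0 ≤ α m) (hα : Tendsto α atTop (𝓝 0))
    (hsum : Tendsto (fun M => ∑ m ∈ Finset.range M, α m) atTop atTop)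
    (hε : ∀ m, 0 ≤ ε m) (hεs : Summable ε) (hζ : Tendsto ζ atTop (𝓝 0))
    (hrec : ∀ᶠ m in atTop, V (m + 1) ≤ (1 - α m + ε m) * V m + ζ m * α m) :
    Tendsto V atTop (𝓝 0) := by
  -- The factor 2 is chosen because 1 − α + ε ≤ (1 − α)(1 + 2ε) when α ≤ 1/2. Hence V/P obeys the
  -- recursion without ε, and P stays bounded because ε is summable.
  set P : ℕ → ℝ := fun m => ∏ j ∈ Finset.range m, (1 + 2 * ε j) with hP
  have hP1 : ∀ m, 1 ≤ P m := fun m =>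
    Finset.prod_induction (fun j => 1 + 2 * ε j) (fun x => 1 ≤ x)
      (fun a b ha hb => one_le_mul_of_one_le_of_one_le ha hb) le_rfl
      fun j _ => by linarith [hε j]
  have hPb : ∀ m, P m ≤ Real.exp (2 * ∑' j, ε j) := by
    intro m
    calc P m ≤ ∏ j ∈ Finset.range m, Real.exp (2 * ε j) :=
          Finset.prod_le_prod (fun j _ => by linarith [hε j]) fun j _ => by
            linarith [Real.add_one_le_exp (2 * ε j)]
      _ = Real.exp (2 * ∑ j ∈ Finset.range m, ε j) := by rw [← Real.exp_sum, Finset.mul_sum]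
      _ ≤ _ := by
          gcongr
          exact hεs.sum_le_tsum _ fun j _ => hε j
  have hW : Tendsto (fun m => V m / P m) atTop (𝓝 0) := by
    refine tendsto_zero_of_gain_recursion (α := α) (ζ := fun m => |ζ m|)
      (fun m => div_nonneg (hV m) (by linarith [hP1 m])) (Eventually.of_forall hα0)
      (hα.eventually_le_const one_pos) hsum (by simpa using hζ.abs) ?_
    filter_upwards [hrec, hα.eventually_le_const (show (0 : ℝ) < 1 / 2 by norm_num)] with m hm hm'
    have hPm : 0 < P m := by linarith [hP1 m]
    have hPs : P (m + 1) = P m * (1 + 2 * ε m) := by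
      simp only [hP]; rw [Finset.prod_range_succ]
    rw [div_le_iff₀ (by linarith [hP1 (m + 1)])]
    have h1 : (1 - α m + ε m) * V m ≤ (1 - α m) * (V m / P m) * P (m + 1) := by
      have e : (1 - α m) * (V m / P m) * P (m + 1) = (1 - α m) * (1 + 2 * ε m) * V m := by
        rw [hPs]; field_simp
      rw [e]
      refine mul_le_mul_of_nonneg_right ?_ (hV m)
      nlinarith [hε m, mul_nonneg (hε m) (hα0 m)]
    have h2 : ζ m * α m ≤ |ζ m| * α m * P (m + 1) := by
      have h3 : 0 ≤ |ζ m| * α m := mul_nonneg (abs_nonneg _) (hα0 m)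
      calc ζ m * α m ≤ |ζ m| * α m := mul_le_mul_of_nonneg_right (le_abs_self _) (hα0 m)
        _ ≤ _ := le_mul_of_one_le_right h3 (hP1 _)
    nlinarith
  have hb : Tendsto (fun m => V m / P m * Real.exp (2 * ∑' j, ε j)) atTop (𝓝 0) := by
    simpa using hW.mul_const (Real.exp (2 * ∑' j, ε j))
  refine squeeze_zero hV (fun m => ?_) hb
  have hPm : 0 < P m := by linarith [hP1 m]
  calc V m = V m / P m * P m := by field_simp
    _ ≤ _ := mul_le_mul_of_nonneg_left (hPb m) (div_nonneg (hV m) hPm.le)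

/-- A recursion with delays inherits the decay of its forcing term. -/
theorem exists_le_sq_of_delay_recursion {d : ℕ} {Q : ℤ → ℝ} {a b : ℕ → ℝ} {A B c : ℝ}
    (hQ : ∀ t, 0 ≤ Q t) (ha : ∀ k, 0 < a k) (hA : 0 ≤ A) (hB : 0 ≤ B)
    (hb : Tendsto b atTop (𝓝 0)) (hc : ∀ k j, j ≤ d → a k ≤ c * a (k + j))
    (hrec : ∀ k : ℕ, Q k ≤ A * a k ^ 2 + B * b k ^ 2 * ∑ i ∈ Finset.range d, Q (k - (i + 1 : ℕ))) :
    ∃ K, 0 ≤ K ∧ ∀ k : ℕ, Q k ≤ K * a k ^ 2 := by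
  have h0 : Tendsto (fun k => B * b k ^ 2 * (d * c ^ 2)) atTop (𝓝 0) := by
    simpa using ((hb.pow 2).const_mul B).mul_const (d * c ^ 2)
  obtain ⟨K0, hK0⟩ := eventually_atTop.1 (h0.eventually_le_const (show (0 : ℝ) < 1 / 2 by norm_num))
  -- Beyond K0 the delayed terms contribute at most half of the target bound. Beyond d all delayed
  -- times are nonnegative, so the initial data no longer enter.
  set K1 := max K0 d with hK1
  -- The finite sum takes care of the first K1 indices; the summand 2A gives A + M/2 ≤ M for the
  -- others.
  set M := 2 * A + ∑ k ∈ Finset.range K1, Q k / a k ^ 2 with hM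
  have hterm : ∀ k : ℕ, 0 ≤ Q k / a k ^ 2 := fun k => div_nonneg (hQ _) (sq_nonneg _)
  have hMA : 2 * A ≤ M := by
    have : 0 ≤ ∑ k ∈ Finset.range K1, Q k / a k ^ 2 := Finset.sum_nonneg fun k _ => hterm k
    linarith
  refine ⟨M, by linarith, fun k => ?_⟩
  induction k using Nat.strong_induction_on with
  | _ k ih =>
    have hak : 0 < a k ^ 2 := by have := ha k; positivity
    rcases lt_or_ge k K1 with hk | hk
    · rw [← div_le_iff₀ hak]
      have := Finset.single_le_sum (f := fun k : ℕ => Q k / a k ^ 2) (fun k _ => hterm k)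
        (Finset.mem_range.2 hk)
      linarith
    · have hkd : d ≤ k := (le_max_right _ _).trans hk
      have hkK : K0 ≤ k := (le_max_left _ _).trans hk
      have hsum : ∑ i ∈ Finset.range d, Q (k - (i + 1 : ℕ)) ≤ d * c ^ 2 * (M * a k ^ 2) := by
        calc _ ≤ ∑ i ∈ Finset.range d, M * (c * a k) ^ 2 := by
              refine Finset.sum_le_sum fun i hi => ?_
              have hi' := Finset.mem_range.1 hi
              have e : ((k : ℤ) - (i + 1 : ℕ)) = ((k - (i + 1) : ℕ) : ℤ) := by omega
              rw [e]
              refine (ih _ (by omega)).trans ?_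
              have h1 := hc (k - (i + 1)) (i + 1) (by omega)
              rw [Nat.sub_add_cancel (by omega)] at h1
              have h2 := (ha (k - (i + 1))).le
              have h3 : 0 ≤ M := by linarith
              gcongr
          _ = _ := by rw [Finset.sum_const, Finset.card_range, nsmul_eq_mul]; ring
      have hBb : 0 ≤ B * b k ^ 2 := by positivity
      have h1 := hrec k
      have h2 := mul_le_mul_of_nonneg_left hsum hBb
      have h3 := mul_le_mul_of_nonneg_right (hK0 k hkK)
        (show 0 ≤ M * a k ^ 2 from mul_nonneg (by linarith) hak.le)
      nlinarith

/-- Variation of a slowly decreasing gain, in terms of its square root. -/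
theorem div_sub_one_mul_le {x y z b c : ℝ} (hy : 0 < y) (hyz : y ≤ z) (hzx : z ≤ x) (hc : 1 ≤ c)
    (hxy : x ≤ c * y) (hb0 : 0 ≤ b) (hb : b ^ 2 ≤ c * x) :
    (x / z - 1) * b ≤ 2 * c ^ 2 * (√x - √y) := by
  have hx : 0 < x := by linarith
  have hz : 0 < z := by linarith
  have hsx : 0 < √x := Real.sqrt_pos.2 hx
  have hsxy : √y ≤ √x := Real.sqrt_le_sqrt (by linarith)
  have hb' : b ≤ c * √x := by
    refine abs_le_of_sq_le_sq' ?_ (by positivity) |>.2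
    rw [mul_pow, Real.sq_sqrt hx.le]
    nlinarith [mul_nonneg (mul_nonneg (show (0 : ℝ) ≤ c by linarith) (sub_nonneg.2 hc)) hx.le]
  -- Multiplied by b ≤ c√x this becomes c²(x − y)/√x, at most 2c²(√x − √y), a quantity that
  -- telescopes along the blocks.
  have h1 : x / z - 1 ≤ c * ((x - y) / x) := by
    rw [div_sub_one hz.ne', mul_div_assoc', div_le_div_iff₀ hz hx]
    have h2 : 0 ≤ x - z := by linarith
    have h3 : x ≤ c * z := hxy.trans (by gcongr)
    calc (x - z) * x ≤ (x - y) * x := by gcongr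
      _ ≤ (x - y) * (c * z) := mul_le_mul_of_nonneg_left h3 (by linarith)
      _ = _ := by ring
  have h4 : x - y = (√x - √y) * (√x + √y) := by
    have e1 := Real.mul_self_sqrt hx.le
    have e2 := Real.mul_self_sqrt hy.le
    linear_combination e2 - e1
  have hxz : 0 ≤ x / z - 1 := by
    rw [sub_nonneg, one_le_div hz]; exact hzx
  calc (x / z - 1) * b ≤ c * ((x - y) / x) * (c * √x) :=
        mul_le_mul h1 hb' hb0 (hxz.trans h1)
    _ = c ^ 2 * ((√x - √y) * (√x + √y) / √x) := by
        rw [h4]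
        nth_rewrite 3 [← Real.mul_self_sqrt hx.le]
        field_simp
    _ ≤ c ^ 2 * ((√x - √y) * 2) := by
        gcongr
        rw [div_le_iff₀ hsx, mul_assoc]
        refine mul_le_mul_of_nonneg_left ?_ (sub_nonneg.2 hsxy)
        linarith
    _ = _ := by ring

theorem summable_sub_of_antitone {f : ℕ → ℝ} (hf : Antitone f) (h0 : ∀ m, 0 ≤ f m) :
    Summable fun m => f m - f (m + 1) := by
  refine summable_of_sum_range_le (c := f 0) (fun m => sub_nonneg.2 (hf (Nat.le_succ m)))
    fun M => ?_
  rw [Finset.sum_range_sub']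
  linarith [h0 M]

/-- Sampling a divergent antitone series along the multiples of `h`. -/
theorem tendsto_sum_sample_atTop {a : ℕ → ℝ} (ha : Antitone a) {h : ℕ} (hh : 0 < h)
    (hsum : Tendsto (fun K => ∑ k ∈ Finset.range K, a k) atTop atTop) :
    Tendsto (fun M => ∑ m ∈ Finset.range M, a (m * h)) atTop atTop := by
  have h1 : ∀ M, ∑ k ∈ Finset.range (M * h), a k ≤ h * ∑ m ∈ Finset.range M, a (m * h) := by
    intro M
    induction M with
    | zero => simp
    | succ M ih =>
      rw [Finset.sum_range_succ, mul_add, add_mul, one_mul, Finset.sum_range_add]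
      refine add_le_add ih ?_
      calc _ ≤ ∑ _i ∈ Finset.range h, a (M * h) :=
            Finset.sum_le_sum fun i _ => ha (Nat.le_add_right _ _)
        _ = _ := by simp
  have h2 : Tendsto (fun M => ∑ k ∈ Finset.range (M * h), a k) atTop atTop :=
    hsum.comp (tendsto_id.atTop_mul_const' hh)
  have h3 := tendsto_atTop_mono h1 h2
  have hh' : (0 : ℝ) < h := by exact_mod_cast hh
  exact (tendsto_const_mul_atTop_of_pos hh').1 h3

/-! ### Sigma-fields and adaptedness of the random data. -/

namespace Network

variable {Ω : Type*} [mΩ : MeasurableSpace Ω] {μ : Measure Ω} {N n d : ℕ} {p : Fin N → ℕ}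
  (S : Network μ N n d p)

/-- The sigma-field of all graphs, observation matrices and delays. -/
abbrev sigmaAllSystem : MeasurableSpace Ω := ⨆ s, S.sigmaSystem s

/-- The sigma-field of the noise before time `k`. -/
abbrev noisePast (k : ℕ) : MeasurableSpace Ω := ⨆ s ∈ Set.Iio k, S.sigmaNoise s

theorem sigmaNoise_le (s : ℕ) : S.sigmaNoise s ≤ mΩ := (S.measurable_v s).comap_le

theorem sigmaSystem_le (s : ℕ) : S.sigmaSystem s ≤ mΩ := by
  refine sup_le (sup_le ?_ ?_) ?_
  · exact iSup_le fun i => iSup_le fun j => (S.measurable_adj s i j).comap_le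
  · exact iSup_le fun i => iSup_le fun r => iSup_le fun c => (S.measurable_H s i r c).comap_le
  · exact iSup_le fun j => iSup_le fun i => (S.measurable_delay s j i).comap_le

theorem past_le (k : ℕ) : S.past k ≤ mΩ :=
  iSup₂_le fun s _ => sup_le (S.sigmaNoise_le s) (S.sigmaSystem_le s)

theorem sigmaAllSystem_le : S.sigmaAllSystem ≤ mΩ := iSup_le S.sigmaSystem_le

theorem noisePast_le (k : ℕ) : S.noisePast k ≤ mΩ := iSup₂_le fun s _ => S.sigmaNoise_le s

theorem noisePast_le_past (k : ℕ) : S.noisePast k ≤ S.past k :=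
  iSup₂_mono fun _ _ => le_sup_left

theorem past_mono {k l : ℕ} (hkl : k ≤ l) : S.past k ≤ S.past l :=
  biSup_mono fun _ hs => lt_of_lt_of_le hs hkl

theorem sigmaNoise_le_past {s k : ℕ} (h : s < k) : S.sigmaNoise s ≤ S.past k :=
  le_sup_left.trans (le_iSup₂ (f := fun s (_ : s ∈ Set.Iio k) =>
    S.sigmaNoise s ⊔ S.sigmaSystem s) s h)

theorem sigmaSystem_le_past {s k : ℕ} (h : s < k) : S.sigmaSystem s ≤ S.past k :=
  le_sup_right.trans (le_iSup₂ (f := fun s (_ : s ∈ Set.Iio k) =>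
    S.sigmaNoise s ⊔ S.sigmaSystem s) s h)

/-- In the larger field the whole system is revealed at once and only the noise is filtered in time;
that is the field on which independence will be used. -/
theorem past_le_noisePast_sup {k l : ℕ} (hkl : k ≤ l) :
    S.past k ≤ S.noisePast l ⊔ S.sigmaAllSystem :=
  iSup₂_le fun s hs => sup_le_sup
    (le_iSup₂ (f := fun s (_ : s ∈ Set.Iio l) => S.sigmaNoise s) s (lt_of_lt_of_le hs hkl))
    (le_iSup S.sigmaSystem s)

theorem measurable_adj_sigma (k : ℕ) (i j : Fin N) :
    Measurable[S.sigmaSystem k] fun ω => S.adj k ω i j := by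
  have h : MeasurableSpace.comap (fun ω => S.adj k ω i j) inferInstance ≤ S.sigmaSystem k :=
    le_sup_of_le_left (le_sup_of_le_left (le_iSup₂ (f := fun i j =>
      MeasurableSpace.comap (fun ω => S.adj k ω i j) inferInstance) i j))
  exact (comap_measurable _).mono h le_rfl

theorem measurable_H_sigma (k : ℕ) (i : Fin N) (r : Fin (p i)) (c : Fin n) :
    Measurable[S.sigmaSystem k] fun ω => S.H k i ω r c := by
  have h : MeasurableSpace.comap (fun ω => S.H k i ω r c) inferInstance ≤ S.sigmaSystem k := by
    refine le_sup_of_le_left (le_sup_of_le_right ?_)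
    refine le_iSup_of_le i (le_iSup₂ (f := fun r c =>
      MeasurableSpace.comap (fun ω => S.H k i ω r c) inferInstance) r c)
  exact (comap_measurable _).mono h le_rfl

theorem measurable_delay_sigma (k : ℕ) (j i : Fin N) :
    Measurable[S.sigmaSystem k] (S.delay k j i) := by
  have h : MeasurableSpace.comap (S.delay k j i) inferInstance ≤ S.sigmaSystem k :=
    le_sup_of_le_right (le_iSup₂ (f := fun j i =>
      MeasurableSpace.comap (S.delay k j i) inferInstance) j i)
  exact (comap_measurable _).mono h le_rfl

theorem measMat_adj (k : ℕ) : MeasMat (S.sigmaSystem k) (S.adj k) := S.measurable_adj_sigma k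

theorem measMat_degMat (k : ℕ) : MeasMat (S.sigmaSystem k) (S.degMat k) := by
  intro i j
  by_cases h : i = j
  · subst h
    simp only [degMat, Matrix.diagonal_apply_eq]
    exact Finset.measurable_sum _ fun j _ => S.measurable_adj_sigma k i j
  · simp only [degMat, Matrix.diagonal_apply_ne _ h]
    exact measurable_const

theorem measMat_laplSym (k : ℕ) : MeasMat (S.sigmaSystem k) (S.laplSym k) := by
  have h : MeasMat (S.sigmaSystem k) (S.lapl k) := (S.measMat_degMat k).sub (S.measMat_adj k)
  exact (h.add h.transpose).smul _

theorem measMat_Hdiag (k : ℕ) : MeasMat (S.sigmaSystem k) (S.Hdiag k) := by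
  intro r c
  by_cases h : r.1 = c.1
  · simp only [Hdiag, Matrix.of_apply, h, if_true]
    exact S.measurable_H_sigma k r.1 r.2 c.2
  · simp only [Hdiag, Matrix.of_apply, h, if_false]
    exact measurable_const

theorem measMat_Abar (k q : ℕ) : MeasMat (S.sigmaSystem k) (S.Abar k q) := by
  have h : MeasMat (S.sigmaSystem k) fun ω => S.adj k ω ⊙ S.delayMat k q ω := by
    intro i j
    simp only [Matrix.hadamard_apply, delayMat, Matrix.of_apply]
    refine (S.measurable_adj_sigma k i j).mul ?_
    exact (measurable_of_finite fun x : Fin (d + 1) => if (x : ℕ) = q then (1 : ℝ) else 0).comp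
      (S.measurable_delay_sigma k j i)
  exact h.kronecker_one

/-- The field is ℱ(t). For t < 0 the truncation `toNat` gives the trivial field, which suffices
since F is then constant. -/
theorem measMat_F (t : ℤ) : MeasMat (S.past (t + 1).toNat) fun ω => S.F ω t := by
  rcases lt_or_ge t 0 with ht | ht
  · simp only [S.F_of_neg _ ht]
    exact MeasMat.const 1
  · lift t to ℕ using ht
    induction t using Nat.strong_induction_on with
    | _ k ih =>
      have hk : ((k : ℤ) + 1).toNat = k + 1 := by omega
      rw [hk]
      simp only [F_natCast, Gmat]
      have hle := S.sigmaSystem_le_past (Nat.lt_succ_self k)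
      refine (MeasMat.const 1).sub ((MeasMat.add ?_ ?_).sub (MeasMat.smul _ ?_))
      · exact (((S.measMat_degMat k).mono hle).kronecker_one).smul _
      · exact (((S.measMat_Hdiag k).mono hle).transpose.mul ((S.measMat_Hdiag k).mono hle)).smul _
      · refine MeasMat.sum _ fun q _ => ((S.measMat_Abar k q).mono hle).mul (MeasMat.inv ?_)
        refine MeasMat.transProd fun t ht => ?_
        rcases lt_or_ge t 0 with h0 | h0
        · simp only [S.F_of_neg _ h0]
          exact MeasMat.const 1
        · lift t to ℕ using h0
          exact (ih t (by omega)).mono (S.past_mono (by omega))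

theorem measMat_Gmat (k : ℕ) : MeasMat (S.past (k + 1)) fun ω => S.Gmat k ω (S.F ω) := by
  have h : MeasMat (S.past (k + 1)) fun ω => 1 - S.F ω k := by
    have := S.measMat_F k
    rw [show ((k : ℤ) + 1).toNat = k + 1 by omega] at this
    exact (MeasMat.const 1).sub this
  intro i j
  have := h i j
  simpa only [F_natCast, sub_sub_cancel] using this

theorem measurable_obsNoise (k : ℕ) : Measurable[S.past (k + 1)] (S.obsNoise k) :=
  ((S.measMat_Hdiag k).mono (S.sigmaSystem_le_past (Nat.lt_succ_self k))).transpose.act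
    ((comap_measurable _).mono (S.sigmaNoise_le_past (Nat.lt_succ_self k)) le_rfl)

/-- The error at time t uses only data up to t − 1. This is what permits conditioning on the field
at the start of a block. -/
theorem measurable_err (t : ℤ) : Measurable[S.past t.toNat] fun ω => S.err ω t := by
  rcases le_or_gt t 0 with ht | ht
  · simp only [err, S.estimate_of_nonpos _ ht]
    exact measurable_const
  · obtain ⟨k, rfl⟩ : ∃ k : ℕ, t = (k : ℤ) + 1 := ⟨(t - 1).toNat, by omega⟩
    clear ht
    induction k using Nat.strong_induction_on with
    | _ k ih =>
      have hk : ((k : ℤ) + 1).toNat = k + 1 := by omega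
      rw [hk]
      have hle := S.sigmaSystem_le_past (Nat.lt_succ_self k)
      have herr : ∀ s : ℤ, s ≤ k → Measurable[S.past (k + 1)] fun ω => S.err ω s := by
        intro s hs
        rcases le_or_gt s 0 with h0 | h0
        · simp only [err, S.estimate_of_nonpos _ h0]
          exact measurable_const
        · obtain ⟨l, rfl⟩ : ∃ l : ℕ, s = (l : ℤ) + 1 := ⟨(s - 1).toNat, by omega⟩
          exact (ih l (by omega)).mono (S.past_mono (by omega)) le_rfl
      have hsmul : ∀ (c : ℝ) (f : Ω → EuclideanSpace ℝ (Fin N × Fin n)),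
          Measurable[S.past (k + 1)] f → Measurable[S.past (k + 1)] fun ω => c • f ω :=
        fun c f hf => hf.const_smul c
      simp only [err_succ]
      refine Measurable.add (Measurable.add (Measurable.sub (Measurable.sub (herr k le_rfl) ?_) ?_)
        ?_) ?_
      · exact hsmul _ _ (((S.measMat_degMat k).mono hle).kronecker_one.act (herr k le_rfl))
      · exact hsmul _ _ ((((S.measMat_Hdiag k).mono hle).transpose.mul
          ((S.measMat_Hdiag k).mono hle)).act (herr k le_rfl))
      · exact hsmul _ _ (S.measurable_obsNoise k)
      · refine hsmul _ _ (Finset.measurable_sum _ fun q _ => ?_)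
        exact ((S.measMat_Abar k q).mono hle).act (herr _ (by omega))

theorem measurable_res (t : ℤ) : Measurable[S.past (t + 1).toNat] fun ω => S.res ω t :=
  (S.measurable_err (t + 1)).sub ((S.measMat_F t).act
    ((S.measurable_err t).mono (S.past_mono (by omega)) le_rfl))

end Network
-- Set integrals, independence, and conditional expectations of quadratic forms.
section Probability

variable {Ω ι : Type*} [Fintype ι] {m m₁ m₂ m' : MeasurableSpace Ω} [mΩ : MeasurableSpace Ω]
  {μ : Measure Ω}

theorem memLp_coord {x : Ω → EuclideanSpace ℝ ι} (hx : MemLp x 2 μ) (i : ι) :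
    MemLp (fun ω => x ω i) 2 μ :=
  (EuclideanSpace.proj (𝕜 := ℝ) i).comp_memLp' hx

theorem integrable_norm_sq {x : Ω → EuclideanSpace ℝ ι} (hx : MemLp x 2 μ) :
    Integrable (fun ω => ‖x ω‖ ^ 2) μ :=
  hx.integrable_norm_pow (by norm_num)

theorem integrable_coord_mul_entry {x : Ω → EuclideanSpace ℝ ι} (hx : MemLp x 2 μ)
    {f : Ω → ℝ} (hf : Measurable f) {C : ℝ} (hC : ∀ᵐ ω ∂μ, |f ω| ≤ C) (i j : ι) :
    Integrable (fun ω => (x ω i * x ω j) * f ω) μ := by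
  have h1 : Integrable (fun ω => x ω i * x ω j) μ := (memLp_coord hx i).integrable_mul (memLp_coord hx j)
  exact h1.mul_bdd (c := C) hf.aestronglyMeasurable (by simpa using hC)

theorem condExpMat_kronecker_one {n N : ℕ} (M : Ω → Matrix (Fin N) (Fin N) ℝ) (ω : Ω) :
    condExpMat μ m (fun ω => M ω ⊗ₖ (1 : Matrix (Fin n) (Fin n) ℝ)) ω
      = condExpMat μ m M ω ⊗ₖ (1 : Matrix (Fin n) (Fin n) ℝ) := by
  ext i j
  by_cases hij : i.2 = j.2
  · simp [condExpMat, Matrix.kroneckerMap_apply, Matrix.one_apply, hij]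
  · have e : (fun ω' => (M ω' ⊗ₖ (1 : Matrix (Fin n) (Fin n) ℝ)) i j) = 0 := by
      funext ω'
      simp [Matrix.kroneckerMap_apply, Matrix.one_apply_ne hij]
    simp only [condExpMat, Matrix.of_apply, e, condExp_zero]
    simp [Matrix.kroneckerMap_apply, Matrix.one_apply_ne hij]

variable [IsProbabilityMeasure μ]

/-- Adjoining an independent sigma-field does not change the vanishing of set integrals. -/
theorem setIntegral_eq_zero_of_indep_sup (hm₁ : m₁ ≤ m')
    (hm' : m' ≤ mΩ) (hm₂ : m₂ ≤ mΩ) (hindep : Indep m' m₂ μ) {f : Ω → ℝ}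
    (hf : StronglyMeasurable[m'] f) (hfi : Integrable f μ)
    (h0 : ∀ A, MeasurableSet[m₁] A → ∫ ω in A, f ω ∂μ = 0) {s : Set Ω}
    (hs : MeasurableSet[m₁ ⊔ m₂] s) : ∫ ω in s, f ω ∂μ = 0 := by
  have hle : m₁ ⊔ m₂ ≤ mΩ := sup_le (hm₁.trans hm') hm₂
  have hgen : m₁ ⊔ m₂ = MeasurableSpace.generateFrom
      {s | ∃ A B, MeasurableSet[m₁] A ∧ MeasurableSet[m₂] B ∧ s = A ∩ B} := by
    refine le_antisymm (sup_le ?_ ?_) (MeasurableSpace.generateFrom_le ?_)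
    · exact fun A hA => MeasurableSpace.measurableSet_generateFrom
        ⟨A, Set.univ, hA, MeasurableSet.univ, by simp⟩
    · exact fun B hB => MeasurableSpace.measurableSet_generateFrom
        ⟨Set.univ, B, MeasurableSet.univ, hB, by simp⟩
    · rintro _ ⟨A, B, hA, hB, rfl⟩
      exact MeasurableSet.inter ((le_sup_left : m₁ ≤ m₁ ⊔ m₂) _ hA)
        ((le_sup_right : m₂ ≤ m₁ ⊔ m₂) _ hB)
  have hpi : IsPiSystem {s | ∃ A B, MeasurableSet[m₁] A ∧ MeasurableSet[m₂] B ∧ s = A ∩ B} := by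
    rintro _ ⟨A, B, hA, hB, rfl⟩ _ ⟨A', B', hA', hB', rfl⟩ _
    exact ⟨A ∩ A', B ∩ B', hA.inter hA', hB.inter hB', Set.inter_inter_inter_comm _ _ _ _⟩
  induction s, hs using MeasurableSpace.induction_on_inter hgen hpi with
  | empty => simp
  | basic s hs =>
    obtain ⟨A, B, hA, hB, rfl⟩ := hs
    have hA' : MeasurableSet A := hm' _ (hm₁ _ hA)
    have h1 : StronglyMeasurable[m'] (A.indicator f) := hf.indicator (hm₁ _ hA)
    -- The indicator of A times f is independent of m₂, so its conditional expectation is its mean,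
    -- the integral of f over A, which is 0. Integrating over B settles the generating sets A ∩ B.
    have h2 := condExp_indep_eq (μ := μ) hm' hm₂ h1 hindep
    have h3 : μ[A.indicator f] = 0 := by
      rw [integral_indicator hA']
      exact h0 A hA
    have h4 := setIntegral_condExp hm₂ (hfi.indicator hA') hB
    rw [Set.inter_comm, ← setIntegral_indicator hA', ← h4,
      setIntegral_congr_ae (g := fun _ => (0 : ℝ)) (hm₂ _ hB)
        (h2.mono fun ω hω _ => by rw [hω, h3])]
    simp
  | compl s hs ih =>
    have h1 := integral_add_compl (hle _ hs) hfi
    have h2 := h0 Set.univ MeasurableSet.univ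
    rw [setIntegral_univ] at h2
    linarith
  | iUnion g hd hg ih =>
    rw [integral_iUnion (fun i => hle _ (hg i)) hd hfi.integrableOn]
    simp [ih]

/-- Vanishing set integrals say that the conditional expectation of f is 0, and the measurable
factor g can be pulled out of it. -/
theorem integral_mul_eq_zero_of_setIntegral_eq_zero (hm : m ≤ mΩ)
    {f g : Ω → ℝ} (hfi : Integrable f μ)
    (h0 : ∀ A, MeasurableSet[m] A → ∫ ω in A, f ω ∂μ = 0) (hg : StronglyMeasurable[m] g)
    (hgf : Integrable (g * f) μ) : ∫ ω, (g * f) ω ∂μ = 0 := by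
  have h1 : (0 : Ω → ℝ) =ᵐ[μ] μ[f | m] := by
    refine ae_eq_condExp_of_forall_setIntegral_eq hm hfi (fun s _ _ => integrableOn_zero) ?_
      (stronglyMeasurable_zero.aestronglyMeasurable)
    intro s hs _
    simp [h0 s hs]
  have h2 := condExp_mul_of_stronglyMeasurable_left (μ := μ) hg hgf hfi
  rw [← integral_condExp hm, integral_congr_ae (g := fun _ => (0 : ℝ))]
  · simp
  · filter_upwards [h1, h2] with ω e1 e2
    rw [e2, Pi.mul_apply, ← e1]
    simp

/-- Pulling a square integrable vector out of a conditional expectation. -/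
theorem integral_inner_act_eq_condExpMat (hm : m ≤ mΩ) {x : Ω → EuclideanSpace ℝ ι}
    (hx : MemLp x 2 μ) (hxm : Measurable[m] x) {M : Ω → Matrix ι ι ℝ} (hM : MeasMat mΩ M) {C : ℝ}
    (hC : ∀ᵐ ω ∂μ, ∀ i j, |M ω i j| ≤ C) :
    Integrable (fun ω => inner ℝ (x ω) (act (M ω) (x ω))) μ ∧
    Integrable (fun ω => inner ℝ (x ω) (act (condExpMat μ m M ω) (x ω))) μ ∧
    ∫ ω, inner ℝ (x ω) (act (M ω) (x ω)) ∂μ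
      = ∫ ω, inner ℝ (x ω) (act (condExpMat μ m M ω) (x ω)) ∂μ := by
  have hcoord : ∀ i, Measurable[m] fun ω => x ω i := fun i =>
    (measurable_pi_apply i).comp ((WithLp.measurable_ofLp 2 _).comp hxm)
  have h1 : ∀ i j, Integrable ((fun ω => x ω i * x ω j) * (fun ω => M ω i j)) μ := fun i j =>
    integrable_coord_mul_entry hx (hM i j) (hC.mono fun ω h => h i j) i j
  have hMi : ∀ i j, Integrable (fun ω => M ω i j) μ := fun i j =>
    Integrable.of_bound (hM i j).aestronglyMeasurable C (hC.mono fun ω h => by simpa using h i j)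
  have h2 : ∀ i j, μ[(fun ω => x ω i * x ω j) * (fun ω => M ω i j) | m]
      =ᵐ[μ] (fun ω => x ω i * x ω j) * μ[fun ω => M ω i j | m] := fun i j =>
    condExp_mul_of_stronglyMeasurable_left ((hcoord i).mul (hcoord j)).stronglyMeasurable
      (h1 i j) (hMi i j)
  -- The product is almost surely a conditional expectation, hence integrable; no bound on the
  -- conditioned entries is needed.
  have h3 : ∀ i j, Integrable ((fun ω => x ω i * x ω j) * μ[fun ω => M ω i j | m]) μ :=
    fun i j => integrable_condExp.congr (h2 i j)
  have e1 : (fun ω => inner ℝ (x ω) (act (M ω) (x ω)))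
      = fun ω => ∑ i, ∑ j, ((fun ω => x ω i * x ω j) * (fun ω => M ω i j)) ω := by
    funext ω
    simp only [inner_act, Pi.mul_apply, mul_assoc]
  have e2 : (fun ω => inner ℝ (x ω) (act (condExpMat μ m M ω) (x ω)))
      = fun ω => ∑ i, ∑ j, ((fun ω => x ω i * x ω j) * μ[fun ω => M ω i j | m]) ω := by
    funext ω
    simp only [inner_act, Pi.mul_apply, mul_assoc]
    rfl
  rw [e1, e2]
  refine ⟨integrable_finsetSum _ fun i _ => integrable_finsetSum _ fun j _ => h1 i j,
    integrable_finsetSum _ fun i _ => integrable_finsetSum _ fun j _ => h3 i j, ?_⟩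
  rw [integral_finsetSum _ fun i _ => integrable_finsetSum _ fun j _ => h1 i j,
    integral_finsetSum _ fun i _ => integrable_finsetSum _ fun j _ => h3 i j]
  refine Finset.sum_congr rfl fun i _ => ?_
  rw [integral_finsetSum _ fun j _ => h1 i j, integral_finsetSum _ fun j _ => h3 i j]
  refine Finset.sum_congr rfl fun j _ => ?_
  rw [← integral_condExp hm, integral_congr_ae (h2 i j)]

end Probability

/-! ### Orthogonality of the noise to the past errors. -/

namespace Network

variable {Ω : Type*} [mΩ : MeasurableSpace Ω] {μ : Measure Ω} [IsProbabilityMeasure μ]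
  {N n d : ℕ} {p : Fin N → ℕ} {S : Network μ N n d p}

/-- The noise is orthogonal to everything that depends on its past and on the whole system. -/
theorem integral_mul_noise_eq_zero (hindep : S.NoiseIndep) (hv : ∀ k, MemLp (S.v k) 2 μ)
    (hmds : ∀ k, μ[S.v k | S.past k] =ᵐ[μ] 0) (k : ℕ) (r : Σ i : Fin N, Fin (p i)) {g : Ω → ℝ}
    (hg : Measurable[S.noisePast k ⊔ S.sigmaAllSystem] g) (hg2 : MemLp g 2 μ) :
    ∫ ω, g ω * S.v k ω r ∂μ = 0 := by
  have hm' : (⨆ k, S.sigmaNoise k) ≤ mΩ := iSup_le S.sigmaNoise_le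
  have hvi : Integrable (S.v k) μ := (hv k).integrable (by norm_num)
  have hvr := memLp_coord (hv k) r
  refine integral_mul_eq_zero_of_setIntegral_eq_zero (f := fun ω => S.v k ω r)
    (sup_le (S.noisePast_le k) S.sigmaAllSystem_le) (hvr.integrable (by norm_num)) ?_
    hg.stronglyMeasurable (hg2.integrable_mul hvr)
  intro A hA
  -- The martingale difference property is first restricted from the full past to the noise past;
  -- independence then adjoins the entire system, future included.
  refine setIntegral_eq_zero_of_indep_sup (m₁ := S.noisePast k) (m₂ := S.sigmaAllSystem)
    (iSup₂_le fun s _ => le_iSup S.sigmaNoise s) hm' S.sigmaAllSystem_le hindep ?_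
    (hvr.integrable (by norm_num)) ?_ hA
  · refine Measurable.stronglyMeasurable ?_
    exact (measurable_pi_apply r).comp ((WithLp.measurable_ofLp 2 _).comp
      ((comap_measurable (S.v k)).mono (le_iSup S.sigmaNoise k) le_rfl))
  · intro B hB
    have hB' : MeasurableSet[S.past k] B := S.noisePast_le_past k _ hB
    have h1 : ∫ ω in B, S.v k ω ∂μ = 0 := by
      rw [← setIntegral_condExp (S.past_le k) hvi hB', setIntegral_congr_ae (g := fun _ => 0)
        (S.past_le k _ hB') ((hmds k).mono fun ω hω _ => hω)]
      simp
    have h2 := (EuclideanSpace.proj (𝕜 := ℝ) r).integral_comp_comm (hvi.integrableOn (s := B))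
    rw [h1, map_zero] at h2
    exact h2

/-- H(k) need not be ℱ(k−1)-measurable, so the martingale difference property alone does not
suffice. The products of coordinates of x with entries of H(k) are measurable for the noise past
joined with the system, to which v(k) is orthogonal. -/
theorem integral_inner_obsNoise_eq_zero (hindep : S.NoiseIndep) (hv : ∀ k, MemLp (S.v k) 2 μ)
    (hmds : ∀ k, μ[S.v k | S.past k] =ᵐ[μ] 0) {k l : ℕ} (hlk : l ≤ k) {C : ℝ}
    (hH : ∀ᵐ ω ∂μ, ‖S.Hdiag k ω‖ ≤ C) {x : Ω → EuclideanSpace ℝ (Fin N × Fin n)}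
    (hx : Measurable[S.past l] x) (hx2 : MemLp x 2 μ) :
    ∫ ω, inner ℝ (x ω) (S.obsNoise k ω) ∂μ = 0 := by
  have hle : S.sigmaSystem k ≤ S.noisePast k ⊔ S.sigmaAllSystem :=
    (le_iSup S.sigmaSystem k).trans le_sup_right
  have hg : ∀ i j, MemLp (fun ω => x ω i * S.Hdiag k ω j i) 2 μ := by
    intro i j
    refine (memLp_coord hx2 i).of_le_mul (c := C) ?_ ?_
    · exact (memLp_coord hx2 i).aestronglyMeasurable.mul
        ((S.measMat_Hdiag k).mono (S.sigmaSystem_le k) j i).aestronglyMeasurable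
    · filter_upwards [hH] with ω hω
      rw [norm_mul, mul_comm]
      gcongr
      exact (abs_entry_le_norm _ j i).trans hω
  have hgm : ∀ i j, Measurable[S.noisePast k ⊔ S.sigmaAllSystem]
      fun ω => x ω i * S.Hdiag k ω j i := by
    intro i j
    refine Measurable.mul ?_ ((S.measMat_Hdiag k).mono hle j i)
    exact (measurable_pi_apply i).comp ((WithLp.measurable_ofLp 2 _).comp
      (hx.mono (S.past_le_noisePast_sup hlk) le_rfl))
  have e : ∀ ω, inner ℝ (x ω) (S.obsNoise k ω)
      = ∑ i, ∑ j, (x ω i * S.Hdiag k ω j i) * S.v k ω j := by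
    intro ω
    rw [obsNoise, inner_act]
    refine Finset.sum_congr rfl fun i _ => Finset.sum_congr rfl fun j _ => ?_
    rw [Matrix.transpose_apply]; ring
  have hint : ∀ i j, Integrable (fun ω => (x ω i * S.Hdiag k ω j i) * S.v k ω j) μ :=
    fun i j => (hg i j).integrable_mul (memLp_coord (hv k) j)
  simp only [e]
  rw [integral_finsetSum _ fun i _ => integrable_finsetSum _ fun j _ => hint i j]
  refine Finset.sum_eq_zero fun i _ => ?_
  rw [integral_finsetSum _ fun j _ => hint i j]
  exact Finset.sum_eq_zero fun j _ =>
    integral_mul_noise_eq_zero hindep hv hmds k j (hgm i j) (hg i j)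

end Network

/-! ### Moments of the error and of the defect under the consolidated hypotheses. -/

namespace Network

variable {Ω : Type*} [mΩ : MeasurableSpace Ω] {μ : Measure Ω} {N n d : ℕ} {p : Fin N → ℕ}

/-- The consequences of the assumptions that the convergence proof uses, with one constant `c`. -/
structure Regular (S : Network μ N n d p) (h : ℕ) (c : ℝ) : Prop where
  one_le : 1 ≤ c
  a_pos : ∀ k, 0 < S.a k
  b_pos : ∀ k, 0 < S.b k
  a_anti : Antitone S.a
  b_anti : Antitone S.b
  a_lim : Tendsto S.a atTop (𝓝 0)
  b_lim : Tendsto S.b atTop (𝓝 0)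
  a_sum : Tendsto (fun K => ∑ k ∈ Finset.range K, S.a k) atTop atTop
  b_sq_le : ∀ k, S.b k ^ 2 ≤ c * S.a k
  b_sq_isLittleO : (fun k => S.b k ^ 2) =o[atTop] S.a
  a_ratio : ∀ k j, j ≤ d + h → S.a k ≤ c * S.a (k + j)
  memLp_v : ∀ k, MemLp (S.v k) 2 μ
  condExp_v : ∀ k, μ[S.v k | S.past k] =ᵐ[μ] 0
  integral_v : ∀ k, ∫ ω, ‖S.v k ω‖ ^ 2 ∂μ ≤ c
  indep : S.NoiseIndep
  norm_Gmat : ∀ᵐ ω ∂μ, ∀ k, ‖S.Gmat k ω (S.F ω)‖ ≤ c * S.b k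
  norm_Hdiag : ∀ᵐ ω ∂μ, ∀ k, ‖S.Hdiag k ω‖ ≤ c
  norm_delayRes : ∀ᵐ ω ∂μ, ∀ k : ℕ, ‖S.delayRes ω k‖ ≤
    c * S.b k * ∑ i ∈ Finset.range d, ‖S.res ω ((k : ℤ) - (i + 1 : ℕ))‖
  entry_laplSym : ∀ᵐ ω ∂μ, ∀ k i j,
    |(S.laplSym k ω ⊗ₖ (1 : Matrix (Fin n) (Fin n) ℝ)) i j| ≤ c
  entry_Abar : ∀ᵐ ω ∂μ, ∀ k q i j, q ≤ d → |(S.Abar k q ω *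
    ((transProd (S.F ω) ((k : ℤ) - 1) ((k : ℤ) - q))⁻¹ - 1)) i j| ≤ c

variable {S : Network μ N n d p} {h : ℕ} {c : ℝ}

namespace Regular

theorem res_eq (ω : Ω) (k : ℕ) : S.res ω k = S.a k • S.obsNoise k ω + S.delayRes ω k := by
  rw [delayRes]; abel

theorem norm_obsNoise_le (hS : S.Regular h c) :
    ∀ᵐ ω ∂μ, ∀ k, ‖S.obsNoise k ω‖ ≤ c * ‖S.v k ω‖ := by
  filter_upwards [hS.norm_Hdiag] with ω hω k
  refine (norm_act_le _ _).trans ?_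
  rw [norm_transpose_eq]
  gcongr
  exact hω k

theorem measurable_err' (t : ℤ) : Measurable fun ω => S.err ω t :=
  (S.measurable_err t).mono (S.past_le _) le_rfl

theorem measurable_res' (t : ℤ) : Measurable fun ω => S.res ω t :=
  (S.measurable_res t).mono (S.past_le _) le_rfl

theorem measurable_obsNoise' (k : ℕ) : Measurable (S.obsNoise k) :=
  (S.measurable_obsNoise k).mono (S.past_le _) le_rfl

theorem memLp_obsNoise (hS : S.Regular h c) (k : ℕ) : MemLp (S.obsNoise k) 2 μ :=
  (hS.memLp_v k).of_le_mul (measurable_obsNoise' k).aestronglyMeasurable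
    (hS.norm_obsNoise_le.mono fun _ hω => hω k)

theorem measurable_delayRes (k : ℕ) : Measurable fun ω => S.delayRes ω k :=
  (measurable_res' k).sub ((measurable_obsNoise' k).const_smul (S.a k))

theorem memLp_act_Gmat (hS : S.Regular h c) (k : ℕ) {x : Ω → EuclideanSpace ℝ (Fin N × Fin n)}
    (hxm : Measurable x) (hx : MemLp x 2 μ) :
    MemLp (fun ω => act (S.Gmat k ω (S.F ω)) (x ω)) 2 μ := by
  refine hx.of_le_mul (c := c * S.b k)
    (((S.measMat_Gmat k).mono (S.past_le _)).act hxm).aestronglyMeasurable ?_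
  filter_upwards [hS.norm_Gmat] with ω hω
  refine (norm_act_le _ _).trans ?_
  gcongr
  exact hω k

/-- Increments of the error over a block. -/
theorem norm_err_add_sub_le (hS : S.Regular h c) : ∀ᵐ ω ∂μ, ∀ k j : ℕ,
    ‖S.err ω (k + j : ℕ) - S.err ω k‖ ≤ (1 + c * S.b 0) ^ j *
      (j * (c * S.b k * ‖S.err ω k‖) + ∑ l ∈ Finset.range j, ‖S.res ω (k + l : ℕ)‖) := by
  have hc : 0 ≤ c := zero_le_one.trans hS.one_le
  filter_upwards [hS.norm_Gmat] with ω hω k j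
  have hb0 := (hS.b_pos 0).le
  have hbk := (hS.b_pos k).le
  induction j with
  | zero => simp
  | succ j ih =>
    set X := j * (c * S.b k * ‖S.err ω k‖) + ∑ l ∈ Finset.range j, ‖S.res ω (k + l : ℕ)‖ with hX
    set D := S.err ω (k + j : ℕ) - S.err ω k with hD
    have e : S.err ω (k + (j + 1) : ℕ) - S.err ω k = D
        - act (S.Gmat (k + j) ω (S.F ω)) D - act (S.Gmat (k + j) ω (S.F ω)) (S.err ω k)
        + S.res ω (k + j : ℕ) := by
      have h1 : ((k + (j + 1) : ℕ) : ℤ) = ((k + j : ℕ) : ℤ) + 1 := by push_cast; ring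
      rw [h1, S.err_succ_eq, hD, act_sub]
      abel
    -- The same matrix is bounded twice: a constant suffices where it acts on the accumulated
    -- increment D, while the small b(k) must be kept where it acts on e(k).
    have hG0 : ‖S.Gmat (k + j) ω (S.F ω)‖ ≤ c * S.b 0 :=
      (hω _).trans (mul_le_mul_of_nonneg_left (hS.b_anti (Nat.zero_le _)) hc)
    have hGk : ‖S.Gmat (k + j) ω (S.F ω)‖ ≤ c * S.b k :=
      (hω _).trans (mul_le_mul_of_nonneg_left (hS.b_anti (Nat.le_add_right _ _)) hc)
    have h1 : ‖act (S.Gmat (k + j) ω (S.F ω)) D‖ ≤ c * S.b 0 * ‖D‖ :=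
      (norm_act_le _ _).trans (by gcongr)
    have h2 : ‖act (S.Gmat (k + j) ω (S.F ω)) (S.err ω k)‖ ≤ c * S.b k * ‖S.err ω k‖ :=
      (norm_act_le _ _).trans (by gcongr)
    have h3 : (1 : ℝ) ≤ (1 + c * S.b 0) ^ (j + 1) :=
      one_le_pow₀ (by linarith [mul_nonneg hc hb0])
    rw [e, Finset.sum_range_succ]
    have hY : 0 ≤ c * S.b k * ‖S.err ω k‖ + ‖S.res ω (k + j : ℕ)‖ := by positivity
    calc _ ≤ ‖D‖ + c * S.b 0 * ‖D‖ + c * S.b k * ‖S.err ω k‖ + ‖S.res ω (k + j : ℕ)‖ := by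
          refine (norm_add_le _ _).trans (add_le_add_left ?_ _)
          refine (norm_sub_le _ _).trans (add_le_add ?_ h2)
          exact (norm_sub_le _ _).trans (add_le_add_right h1 _)
      _ = (1 + c * S.b 0) * ‖D‖ + (c * S.b k * ‖S.err ω k‖ + ‖S.res ω (k + j : ℕ)‖) := by ring
      _ ≤ (1 + c * S.b 0) * ((1 + c * S.b 0) ^ j * X)
          + (1 + c * S.b 0) ^ (j + 1) * (c * S.b k * ‖S.err ω k‖ + ‖S.res ω (k + j : ℕ)‖) := by
          refine add_le_add (mul_le_mul_of_nonneg_left ih (by positivity)) ?_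
          exact le_mul_of_one_le_left hY h3
      _ = _ := by rw [hX]; push_cast; ring

/-- The constant in the bound for increments over a block. -/
noncomputable def blockConst (S : Network μ N n d p) (h : ℕ) (c : ℝ) : ℝ :=
  (1 + c * S.b 0) ^ h * (h * c + 1)

theorem norm_err_add_sub_le_blockConst (hS : S.Regular h c) : ∀ᵐ ω ∂μ, ∀ k j : ℕ, j ≤ h →
    ‖S.err ω (k + j : ℕ) - S.err ω k‖ ≤ blockConst S h c *
      (S.b k * ‖S.err ω k‖ + ∑ l ∈ Finset.range h, ‖S.res ω (k + l : ℕ)‖) := by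
  have hc : 0 ≤ c := zero_le_one.trans hS.one_le
  filter_upwards [hS.norm_err_add_sub_le] with ω hω k j hj
  have hb0 := (hS.b_pos 0).le
  have hbk := (hS.b_pos k).le
  have h1 : (1 + c * S.b 0) ^ j ≤ (1 + c * S.b 0) ^ h :=
    pow_le_pow_right₀ (by linarith [mul_nonneg hc hb0]) hj
  have h2 : ∑ l ∈ Finset.range j, ‖S.res ω (k + l : ℕ)‖
      ≤ ∑ l ∈ Finset.range h, ‖S.res ω (k + l : ℕ)‖ :=
    Finset.sum_le_sum_of_subset_of_nonneg (Finset.range_subset_range.2 hj)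
      fun _ _ _ => norm_nonneg _
  have hR : 0 ≤ ∑ l ∈ Finset.range h, ‖S.res ω (k + l : ℕ)‖ :=
    Finset.sum_nonneg fun _ _ => norm_nonneg _
  refine (hω k j).trans ?_
  rw [blockConst]
  have h3 : (j : ℝ) ≤ h := by exact_mod_cast hj
  calc _ ≤ (1 + c * S.b 0) ^ h * (h * (c * S.b k * ‖S.err ω k‖)
        + ∑ l ∈ Finset.range h, ‖S.res ω (k + l : ℕ)‖) := by
        refine mul_le_mul h1 (add_le_add ?_ h2) (by positivity) (by positivity)
        exact mul_le_mul_of_nonneg_right h3 (by positivity)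
    _ ≤ (1 + c * S.b 0) ^ h * ((h * c + 1) *
          (S.b k * ‖S.err ω k‖ + ∑ l ∈ Finset.range h, ‖S.res ω (k + l : ℕ)‖)) := by
      refine mul_le_mul_of_nonneg_left ?_ (by positivity)
      have h4 : 0 ≤ (h : ℝ) * c * ∑ l ∈ Finset.range h, ‖S.res ω (k + l : ℕ)‖ := by positivity
      have h5 : 0 ≤ S.b k * ‖S.err ω k‖ := by positivity
      linarith
    _ = _ := by ring

variable [IsProbabilityMeasure μ]

/-- Induction on time through the closed recursion: the defect is dominated by noise and earlier
defects, and before time 0 it is deterministic. -/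
theorem memLp_res (hS : S.Regular h c) (t : ℤ) : MemLp (fun ω => S.res ω t) 2 μ := by
  have hneg : ∀ t < (0 : ℤ), MemLp (fun ω => S.res ω t) 2 μ := by
    intro t ht
    simp only [res, err, S.estimate_of_nonpos _ ht.le, S.F_of_neg _ ht,
      S.estimate_of_nonpos _ (show t + 1 ≤ 0 by omega)]
    exact memLp_const _
  rcases lt_or_ge t 0 with ht | ht
  · exact hneg t ht
  · lift t to ℕ using ht
    induction t using Nat.strong_induction_on with
    | _ k ih =>
      have hsum : MemLp (fun ω => ∑ i ∈ Finset.range d, ‖S.res ω ((k : ℤ) - (i + 1 : ℕ))‖) 2 μ := by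
        refine memLp_finsetSum _ fun i _ => MemLp.norm ?_
        rcases lt_or_ge ((k : ℤ) - (i + 1 : ℕ)) 0 with h0 | h0
        · exact hneg _ h0
        · have e : (k : ℤ) - (i + 1 : ℕ) = ((k - (i + 1) : ℕ) : ℤ) := by omega
          rw [e]
          exact ih _ (by omega)
      have hdr : MemLp (fun ω => S.delayRes ω k) 2 μ :=
        (hsum.const_mul (c * S.b k)).mono' (measurable_delayRes k).aestronglyMeasurable
          (hS.norm_delayRes.mono fun _ hω => hω k)
      simp only [res_eq]
      exact ((hS.memLp_obsNoise k).const_smul (S.a k)).add hdr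

theorem memLp_delayRes (hS : S.Regular h c) (k : ℕ) : MemLp (fun ω => S.delayRes ω k) 2 μ :=
  (hS.memLp_res k).sub ((hS.memLp_obsNoise k).const_smul (S.a k))

theorem memLp_err (hS : S.Regular h c) (k : ℕ) : MemLp (fun ω => S.err ω k) 2 μ := by
  induction k with
  | zero =>
    simp only [err, S.estimate_of_nonpos _ (show ((0 : ℕ) : ℤ) ≤ 0 by simp)]
    exact memLp_const _
  | succ k ih =>
    have e : ∀ ω, S.err ω ((k + 1 : ℕ) : ℤ)
        = S.err ω k - act (S.Gmat k ω (S.F ω)) (S.err ω k) + S.res ω k := by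
      intro ω
      rw [← S.err_succ_eq, Nat.cast_succ]
    simp only [e]
    exact (ih.sub (hS.memLp_act_Gmat k (measurable_err' k) ih)).add (hS.memLp_res k)

theorem integral_norm_delayRes_sq_le (hS : S.Regular h c) (k : ℕ) :
    ∫ ω, ‖S.delayRes ω k‖ ^ 2 ∂μ ≤ c ^ 2 * d * S.b k ^ 2 *
      ∑ i ∈ Finset.range d, ∫ ω, ‖S.res ω ((k : ℤ) - (i + 1 : ℕ))‖ ^ 2 ∂μ := by
  rw [← integral_finsetSum _ fun i _ => integrable_norm_sq (hS.memLp_res _), ← integral_const_mul]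
  refine integral_mono_ae (integrable_norm_sq (hS.memLp_delayRes k))
    ((integrable_finsetSum _ fun i _ => integrable_norm_sq (hS.memLp_res _)).const_mul _) ?_
  filter_upwards [hS.norm_delayRes] with ω hω
  calc ‖S.delayRes ω k‖ ^ 2
      ≤ (c * S.b k * ∑ i ∈ Finset.range d, ‖S.res ω ((k : ℤ) - (i + 1 : ℕ))‖) ^ 2 :=
        pow_le_pow_left₀ (norm_nonneg _) (hω k) 2
    _ = c ^ 2 * S.b k ^ 2 * (∑ i ∈ Finset.range d, ‖S.res ω ((k : ℤ) - (i + 1 : ℕ))‖) ^ 2 := by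
        ring
    _ ≤ c ^ 2 * S.b k ^ 2 *
          (d * ∑ i ∈ Finset.range d, ‖S.res ω ((k : ℤ) - (i + 1 : ℕ))‖ ^ 2) := by
        gcongr
        simpa using sq_sum_le_card_mul_sum_sq (s := Finset.range d)
          (f := fun i => ‖S.res ω ((k : ℤ) - (i + 1 : ℕ))‖)
    _ = _ := by ring

/-- The defect has the size of the gain `a`, its delay part that of `a b`, in mean square. -/
theorem exists_integral_res_le (hS : S.Regular h c) : ∃ K, 0 ≤ K ∧
    (∀ k : ℕ, ∫ ω, ‖S.res ω k‖ ^ 2 ∂μ ≤ K * S.a k ^ 2) ∧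
    ∀ k : ℕ, d ≤ k → ∫ ω, ‖S.delayRes ω k‖ ^ 2 ∂μ ≤ K * (S.a k * S.b k) ^ 2 := by
  have hc : 0 ≤ c := zero_le_one.trans hS.one_le
  -- In both A and B the factor 2 comes from splitting the square. In A, c² bounds H and the last c
  -- bounds E‖v‖²; in B, d comes from Cauchy–Schwarz over the delays.
  obtain ⟨K, hK, hKr⟩ := exists_le_sq_of_delay_recursion (d := d) (a := S.a) (b := S.b)
    (Q := fun t => ∫ ω, ‖S.res ω t‖ ^ 2 ∂μ) (A := 2 * c ^ 3) (B := 2 * (c ^ 2 * d)) (c := c)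
    (fun t => integral_nonneg fun ω => sq_nonneg _) hS.a_pos (by positivity) (by positivity)
    hS.b_lim (fun k j hj => hS.a_ratio k j (by omega)) (by
      intro k
      have h1 : ∫ ω, ‖S.res ω k‖ ^ 2 ∂μ
          ≤ ∫ ω, (2 * S.a k ^ 2 * c ^ 2 * ‖S.v k ω‖ ^ 2 + 2 * ‖S.delayRes ω k‖ ^ 2) ∂μ := by
        refine integral_mono_ae (integrable_norm_sq (hS.memLp_res k))
          (((integrable_norm_sq (hS.memLp_v k)).const_mul _).add
            ((integrable_norm_sq (hS.memLp_delayRes k)).const_mul _)) ?_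
        filter_upwards [hS.norm_obsNoise_le] with ω hω
        rw [res_eq]
        have h2 : ‖S.a k • S.obsNoise k ω + S.delayRes ω k‖
            ≤ S.a k * (c * ‖S.v k ω‖) + ‖S.delayRes ω k‖ := by
          refine (norm_add_le _ _).trans (add_le_add_left ?_ _)
          rw [norm_smul, Real.norm_eq_abs, abs_of_pos (hS.a_pos k)]
          exact mul_le_mul_of_nonneg_left (hω k) (hS.a_pos k).le
        calc _ ≤ (S.a k * (c * ‖S.v k ω‖) + ‖S.delayRes ω k‖) ^ 2 :=
              pow_le_pow_left₀ (norm_nonneg _) h2 2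
          _ ≤ _ := by nlinarith [sq_nonneg (S.a k * (c * ‖S.v k ω‖) - ‖S.delayRes ω k‖)]
      rw [integral_add ((integrable_norm_sq (hS.memLp_v k)).const_mul _)
        ((integrable_norm_sq (hS.memLp_delayRes k)).const_mul _), integral_const_mul,
        integral_const_mul] at h1
      have h2 := hS.integral_norm_delayRes_sq_le k
      have h3 : 2 * S.a k ^ 2 * c ^ 2 * ∫ ω, ‖S.v k ω‖ ^ 2 ∂μ ≤ 2 * S.a k ^ 2 * c ^ 2 * c := by
        gcongr
        exact hS.integral_v k
      refine h1.trans ?_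
      linarith)
  -- The second summand results from inserting the first bound into the delay estimate at the d
  -- preceding times; d ≤ k keeps these nonnegative.
  refine ⟨K + c ^ 2 * d * (d * (c ^ 2 * K)), by positivity, fun k => ?_, fun k hk => ?_⟩
  · refine (hKr k).trans ?_
    gcongr
    have : 0 ≤ c ^ 2 * d * (d * (c ^ 2 * K)) := by positivity
    linarith
  · refine (hS.integral_norm_delayRes_sq_le k).trans ?_
    have h1 : ∑ i ∈ Finset.range d, ∫ ω, ‖S.res ω ((k : ℤ) - (i + 1 : ℕ))‖ ^ 2 ∂μ
        ≤ d * (c ^ 2 * K) * S.a k ^ 2 := by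
      calc _ ≤ ∑ i ∈ Finset.range d, K * (c * S.a k) ^ 2 := by
            refine Finset.sum_le_sum fun i hi => ?_
            have hi' := Finset.mem_range.1 hi
            have e : (k : ℤ) - (i + 1 : ℕ) = ((k - (i + 1) : ℕ) : ℤ) := by omega
            rw [e]
            refine (hKr _).trans ?_
            have h2 := hS.a_ratio (k - (i + 1)) (i + 1) (by omega)
            rw [Nat.sub_add_cancel (by omega)] at h2
            have := (hS.a_pos (k - (i + 1))).le
            gcongr
        _ = _ := by rw [Finset.sum_const, Finset.card_range, nsmul_eq_mul]; ring
    calc _ ≤ c ^ 2 * d * S.b k ^ 2 * (d * (c ^ 2 * K) * S.a k ^ 2) := by gcongr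
      _ = c ^ 2 * d * (d * (c ^ 2 * K)) * (S.a k * S.b k) ^ 2 := by ring
      _ ≤ _ := by
        gcongr
        linarith

end Regular
end Network
-- The conditional drift and the linearization of the recursion over one block.
theorem isHermitian_of_symm {ι : Type*} {M : Matrix ι ι ℝ} (h : ∀ i j, M i j = M j i) :
    M.IsHermitian :=
  Matrix.IsHermitian.ext fun i j => by simpa using h j i

theorem condExpMat_symm {Ω ι : Type*} {m : MeasurableSpace Ω} [MeasurableSpace Ω] {μ : Measure Ω}
    {M : Ω → Matrix ι ι ℝ} (h : ∀ ω i j, M ω i j = M ω j i) (ω : Ω) (i j : ι) :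
    condExpMat μ m M ω i j = condExpMat μ m M ω j i := by
  simp only [condExpMat, Matrix.of_apply, fun ω' => h ω' i j]

/-- A quadratic form does not see the antisymmetric part; hence the symmetrized Laplacian in the
convergence condition. -/
theorem inner_act_symm_kronecker {N n : ℕ} (M : Matrix (Fin N) (Fin N) ℝ)
    (x : EuclideanSpace ℝ (Fin N × Fin n)) :
    inner ℝ x (act (((1 / 2 : ℝ) • (M + Mᵀ)) ⊗ₖ (1 : Matrix (Fin n) (Fin n) ℝ)) x)
      = inner ℝ x (act (M ⊗ₖ (1 : Matrix (Fin n) (Fin n) ℝ)) x) := by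
  have e : ((1 / 2 : ℝ) • (M + Mᵀ)) ⊗ₖ (1 : Matrix (Fin n) (Fin n) ℝ)
      = (1 / 2 : ℝ) • (M ⊗ₖ (1 : Matrix (Fin n) (Fin n) ℝ)
        + (M ⊗ₖ (1 : Matrix (Fin n) (Fin n) ℝ))ᵀ) := by
    rw [Matrix.smul_kronecker, Matrix.add_kronecker, ← Matrix.kroneckerMap_transpose, Matrix.transpose_one]
  rw [e, smul_act, add_act, inner_smul_right, inner_add_right, inner_act_transpose]
  ring

section Integration

variable {Ω : Type*} [MeasurableSpace Ω] {μ : Measure Ω}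

theorem integrable_inner_of_memLp {ι : Type*} [Fintype ι] {x y : Ω → EuclideanSpace ℝ ι}
    (hx : MemLp x 2 μ) (hy : MemLp y 2 μ) : Integrable (fun ω => inner ℝ (x ω) (y ω)) μ :=
  (hx.norm.integrable_mul hy.norm).mono' (hx.aestronglyMeasurable.inner hy.aestronglyMeasurable)
    (Eventually.of_forall fun _ => norm_inner_le_norm _ _)

theorem integral_mul_add_sub_mul_sum {α : Type*} {s : Finset α} {f g : Ω → ℝ} {u : α → Ω → ℝ}
    (hf : Integrable f μ) (hg : Integrable g μ) (hu : ∀ q ∈ s, Integrable (u q) μ) (r : ℝ) :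
    Integrable (fun ω => r * f ω + g ω - r * ∑ q ∈ s, u q ω) μ ∧
      ∫ ω, (r * f ω + g ω - r * ∑ q ∈ s, u q ω) ∂μ
        = r * ∫ ω, f ω ∂μ + ∫ ω, g ω ∂μ - r * ∑ q ∈ s, ∫ ω, u q ω ∂μ := by
  have h1 : Integrable (fun ω => r * f ω + g ω) μ := (hf.const_mul r).add hg
  have h2 : Integrable (fun ω => r * ∑ q ∈ s, u q ω) μ := (integrable_finsetSum _ hu).const_mul r
  refine ⟨h1.sub h2, ?_⟩
  rw [integral_sub h1 h2, integral_add (hf.const_mul r) hg, integral_const_mul,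
    integral_const_mul, integral_finsetSum _ hu]

end Integration

/-- Young's inequality for the remainder terms of the block recursion. -/
theorem two_mul_add_sq_le {a b x y u r s c₁ c₂ : ℝ} (ha : 0 < a) (hb : 0 < b) (hx : 0 ≤ x)
    (hu : 0 ≤ u) (hc₂ : 0 ≤ c₂) (hy : y ≤ c₂ * b * (b * x + r) + s)
    (huc : u ≤ c₁ * (b * x + r)) :
    2 * (x * y) + u ^ 2 ≤ (2 * c₂ * b ^ 2 + c₂ * b * a + a * b + 2 * c₁ ^ 2 * b ^ 2) * x ^ 2
      + (c₂ * b / a + 2 * c₁ ^ 2) * r ^ 2 + s ^ 2 / (a * b) := by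
  -- The weights a here and ab in `h2` fit the moments O(a²) of r² and O(a²b²) of s²: the
  -- coefficient of x² is O(b² + ab), and the other terms have mean O(ab + a²).
  have h1 : 2 * (x * r) ≤ a * x ^ 2 + r ^ 2 / a := by
    have : 0 ≤ (a * x - r) ^ 2 / a := by positivity
    have e : (a * x - r) ^ 2 / a = a * x ^ 2 + r ^ 2 / a - 2 * (x * r) := by
      field_simp; ring
    linarith
  have h2 : 2 * (x * s) ≤ a * b * x ^ 2 + s ^ 2 / (a * b) := by
    have : 0 ≤ (a * b * x - s) ^ 2 / (a * b) := by positivity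
    have e : (a * b * x - s) ^ 2 / (a * b) = a * b * x ^ 2 + s ^ 2 / (a * b) - 2 * (x * s) := by
      field_simp; ring
    linarith
  have h3 : u ^ 2 ≤ 2 * c₁ ^ 2 * (b ^ 2 * x ^ 2 + r ^ 2) := by
    calc u ^ 2 ≤ (c₁ * (b * x + r)) ^ 2 := pow_le_pow_left₀ hu huc 2
      _ ≤ _ := by nlinarith [mul_nonneg (sq_nonneg c₁) (sq_nonneg (b * x - r))]
  have h4 := mul_le_mul_of_nonneg_left hy hx
  have h5 := mul_le_mul_of_nonneg_left h1 (mul_nonneg hc₂ hb.le)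
  have e : c₂ * b * (r ^ 2 / a) = c₂ * b / a * r ^ 2 := by ring
  nlinarith

namespace Network

variable {Ω : Type*} [mΩ : MeasurableSpace Ω] {μ : Measure Ω} {N n d : ℕ} {p : Fin N → ℕ}
  {S : Network μ N n d p} {h : ℕ} {c θ : ℝ}

/-- Every link has exactly one delay in {0, …, d}, so the delay classes partition the adjacency
matrix. -/
theorem sum_Abar (k : ℕ) (ω : Ω) :
    ∑ q ∈ Finset.range (d + 1), S.Abar k q ω = S.adj k ω ⊗ₖ (1 : Matrix (Fin n) (Fin n) ℝ) := by
  ext i j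
  rw [Matrix.sum_apply]
  simp only [Abar, Matrix.kroneckerMap_apply, Matrix.hadamard_apply, delayMat, Matrix.of_apply]
  rw [← Finset.sum_mul, ← Finset.mul_sum, Finset.sum_ite_eq]
  simp [(S.delay k j.1 i.1 ω).isLt]

/-- Splitting each inverse product into the identity and the rest turns the degree matrix into the
Laplacian and leaves the terms that Δ measures. -/
theorem Gmat_eq (k : ℕ) (ω : Ω) :
    S.Gmat k ω (S.F ω) = S.b k • (S.lapl k ω ⊗ₖ (1 : Matrix (Fin n) (Fin n) ℝ))
      + S.a k • ((S.Hdiag k ω)ᵀ * S.Hdiag k ω)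
      - S.b k • ∑ q ∈ Finset.range (d + 1),
        S.Abar k q ω * ((transProd (S.F ω) ((k : ℤ) - 1) ((k : ℤ) - q))⁻¹ - 1) := by
  simp only [Matrix.mul_sub, Matrix.mul_one, Finset.sum_sub_distrib, sum_Abar]
  have e : S.degMat k ω = S.lapl k ω + S.adj k ω := by rw [lapl, sub_add_cancel]
  rw [Gmat, e, Matrix.add_kronecker, smul_sub, smul_add]
  abel

theorem inner_act_Gmat (ha : ∀ k, 0 < S.a k) (k : ℕ) (ω : Ω)
    (x : EuclideanSpace ℝ (Fin N × Fin n)) :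
    inner ℝ x (act (S.Gmat k ω (S.F ω)) x) / S.a k =
      S.b k / S.a k * inner ℝ x (act (S.laplSym k ω ⊗ₖ (1 : Matrix (Fin n) (Fin n) ℝ)) x)
        + inner ℝ x (act ((S.Hdiag k ω)ᵀ * S.Hdiag k ω) x)
        - S.b k / S.a k * ∑ q ∈ Finset.range (d + 1), inner ℝ x (act (S.Abar k q ω *
          ((transProd (S.F ω) ((k : ℤ) - 1) ((k : ℤ) - q))⁻¹ - 1)) x) := by
  have hak := (ha k).ne'
  rw [Gmat_eq, laplSym, inner_act_symm_kronecker, sub_act, add_act, smul_act, smul_act, smul_act,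
    sum_act, inner_sub_right, inner_add_right, inner_smul_right, inner_smul_right,
    inner_smul_right, inner_sum]
  field_simp

/-- The convergence condition bounds the conditional drift from below. -/
theorem mul_norm_sq_le_drift {m : ℕ} {ω : Ω} (hθ : θ ≤ S.lam h m ω - S.Delta h m ω)
    (ha : ∀ k, 0 < S.a k) (hb : ∀ k, 0 < S.b k) (x : EuclideanSpace ℝ (Fin N × Fin n)) :
    θ * ‖x‖ ^ 2 ≤ ∑ k ∈ Finset.Ico (m * h) ((m + 1) * h),
      (S.b k / S.a k * inner ℝ x (act (condExpMat μ (S.past (m * h))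
          (fun ω' => S.laplSym k ω' ⊗ₖ (1 : Matrix (Fin n) (Fin n) ℝ)) ω) x)
        + inner ℝ x (act (condExpMat μ (S.past (m * h))
          (fun ω' => (S.Hdiag k ω')ᵀ * S.Hdiag k ω') ω) x)
        - S.b k / S.a k * ∑ q ∈ Finset.range (d + 1), inner ℝ x (act
          (condExpMat μ (S.past (m * h)) (fun ω' => S.Abar k q ω' *
            ((transProd (S.F ω') ((k : ℤ) - 1) ((k : ℤ) - q))⁻¹ - 1)) ω) x)) := by
  have hlap : ∀ k ω' i j, S.laplSym k ω' i j = S.laplSym k ω' j i := by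
    intro k ω' i j
    simp only [laplSym, Matrix.smul_apply, Matrix.add_apply, Matrix.transpose_apply, smul_eq_mul]
    ring
  have hgram : ∀ k ω' i j, ((S.Hdiag k ω')ᵀ * S.Hdiag k ω') i j
      = ((S.Hdiag k ω')ᵀ * S.Hdiag k ω') j i := by
    intro k ω' i j
    simp only [Matrix.mul_apply, Matrix.transpose_apply, mul_comm]
  have h1 : S.lam h m ω * ‖x‖ ^ 2 ≤ ∑ k ∈ Finset.Ico (m * h) ((m + 1) * h),
      (S.b k / S.a k * inner ℝ x (act (condExpMat μ (S.past (m * h))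
          (fun ω' => S.laplSym k ω' ⊗ₖ (1 : Matrix (Fin n) (Fin n) ℝ)) ω) x)
        + inner ℝ x (act (condExpMat μ (S.past (m * h))
          (fun ω' => (S.Hdiag k ω')ᵀ * S.Hdiag k ω') ω) x)) := by
    refine (lamMin_mul_norm_sq_le (isHermitian_of_symm fun i j => ?_) x).trans_eq ?_
    · simp only [Matrix.sum_apply, Matrix.add_apply, Matrix.smul_apply,
        Matrix.kroneckerMap_apply]
      refine Finset.sum_congr rfl fun k _ => ?_
      rw [condExpMat_symm (hlap k), condExpMat_symm (hgram k), ← Matrix.transpose_apply 1 i.2 j.2,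
        Matrix.transpose_one]
    · rw [sum_act, inner_sum]
      refine Finset.sum_congr rfl fun k _ => ?_
      rw [add_act, smul_act, inner_add_right, inner_smul_right, condExpMat_kronecker_one]
  have h2 : ∑ k ∈ Finset.Ico (m * h) ((m + 1) * h), S.b k / S.a k *
      ∑ q ∈ Finset.range (d + 1), inner ℝ x (act
          (condExpMat μ (S.past (m * h)) (fun ω' => S.Abar k q ω' *
            ((transProd (S.F ω') ((k : ℤ) - 1) ((k : ℤ) - q))⁻¹ - 1)) ω) x)
      ≤ S.Delta h m ω * ‖x‖ ^ 2 := by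
    rw [Delta, Finset.sum_mul]
    refine Finset.sum_le_sum fun k _ => ?_
    rw [mul_assoc, Finset.sum_mul]
    refine mul_le_mul_of_nonneg_left ?_ (div_pos (hb k) (ha k)).le
    exact Finset.sum_le_sum fun q _ => (le_abs_self _).trans (abs_inner_act_le _ _)
  rw [Finset.sum_sub_distrib]
  nlinarith [mul_le_mul_of_nonneg_right hθ (sq_nonneg ‖x‖)]

namespace Regular

/-- The remainder of the linearization of the error recursion over a block. -/
noncomputable def blockRem (S : Network μ N n d p) (ω : Ω) (k j : ℕ) :
    EuclideanSpace ℝ (Fin N × Fin n) :=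
  ∑ l ∈ Finset.range j, (S.delayRes ω (k + l)
    - act (S.Gmat (k + l) ω (S.F ω)) (S.err ω (k + l : ℕ) - S.err ω k))

/-- Freezing e(k) in every G(k+l) makes the drift a quadratic form in a vector known at the start of
the block. The remainder collects the cost of freezing and the delay defects. -/
theorem err_add_eq (ω : Ω) (k j : ℕ) :
    S.err ω (k + j : ℕ) = S.err ω k
      - ∑ l ∈ Finset.range j, act (S.Gmat (k + l) ω (S.F ω)) (S.err ω k)
      + ∑ l ∈ Finset.range j, S.a (k + l) • S.obsNoise (k + l) ω + blockRem S ω k j := by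
  induction j with
  | zero => simp [blockRem]
  | succ j ih =>
    have h1 : ((k + (j + 1) : ℕ) : ℤ) = ((k + j : ℕ) : ℤ) + 1 := by push_cast; ring
    have h2 : S.err ω (k + (j + 1) : ℕ) = S.err ω (k + j : ℕ)
        - act (S.Gmat (k + j) ω (S.F ω)) (S.err ω k)
        + S.a (k + j) • S.obsNoise (k + j) ω + (S.delayRes ω (k + j)
          - act (S.Gmat (k + j) ω (S.F ω)) (S.err ω (k + j : ℕ) - S.err ω k)) := by
      rw [h1, S.err_succ_eq, res_eq, act_sub]
      abel
    have h3 : blockRem S ω k (j + 1) = blockRem S ω k j + (S.delayRes ω (k + j)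
          - act (S.Gmat (k + j) ω (S.F ω)) (S.err ω (k + j : ℕ) - S.err ω k)) :=
      Finset.sum_range_succ _ _
    rw [h2, h3, Finset.sum_range_succ, Finset.sum_range_succ]
    generalize S.delayRes ω (k + j)
      - act (S.Gmat (k + j) ω (S.F ω)) (S.err ω (k + j : ℕ) - S.err ω k) = D
    rw [ih]
    abel

theorem norm_blockRem_le (hS : S.Regular h c) : ∀ᵐ ω ∂μ, ∀ k : ℕ,
    ‖blockRem S ω k h‖ ≤ h * c * blockConst S h c * S.b k *
        (S.b k * ‖S.err ω k‖ + ∑ l ∈ Finset.range h, ‖S.res ω (k + l : ℕ)‖)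
      + ∑ l ∈ Finset.range h, ‖S.delayRes ω (k + l)‖ := by
  have hc : 0 ≤ c := zero_le_one.trans hS.one_le
  filter_upwards [hS.norm_Gmat, hS.norm_err_add_sub_le_blockConst] with ω hω hω' k
  have hbk := (hS.b_pos k).le
  set X := S.b k * ‖S.err ω k‖ + ∑ l ∈ Finset.range h, ‖S.res ω (k + l : ℕ)‖ with hX
  rw [blockRem]
  calc _ ≤ ∑ l ∈ Finset.range h, (‖S.delayRes ω (k + l)‖
        + c * S.b k * (blockConst S h c * X)) := by
        refine (norm_sum_le _ _).trans (Finset.sum_le_sum fun l hl => ?_)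
        refine (norm_sub_le _ _).trans (add_le_add_right ?_ _)
        refine (norm_act_le _ _).trans (mul_le_mul ((hω _).trans ?_)
          (hω' k l (Finset.mem_range.1 hl).le) (norm_nonneg _) (by positivity))
        exact mul_le_mul_of_nonneg_left (hS.b_anti (Nat.le_add_right _ _)) hc
    _ = _ := by
        rw [Finset.sum_add_distrib, Finset.sum_const, Finset.card_range, nsmul_eq_mul]
        ring

/-- The factor by which the block remainder may enlarge the squared error. -/
noncomputable def growth (S : Network μ N n d p) (h : ℕ) (c : ℝ) (k : ℕ) : ℝ :=
  2 * (h * c * blockConst S h c) * S.b k ^ 2 + h * c * blockConst S h c * S.b k * S.a k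
    + S.a k * S.b k + 2 * blockConst S h c ^ 2 * S.b k ^ 2

/-- The square is expanded around e(k). The drift and the noise cross term stay exact, to be handled
in expectation; Young's inequality absorbs the rest. -/
theorem norm_err_add_sq_le (hS : S.Regular h c) : ∀ᵐ ω ∂μ, ∀ k : ℕ,
    ‖S.err ω (k + h : ℕ)‖ ^ 2 ≤ (1 + growth S h c k) * ‖S.err ω k‖ ^ 2
      - 2 * ∑ l ∈ Finset.range h, inner ℝ (S.err ω k) (act (S.Gmat (k + l) ω (S.F ω)) (S.err ω k))
      + 2 * ∑ l ∈ Finset.range h, S.a (k + l) * inner ℝ (S.err ω k) (S.obsNoise (k + l) ω)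
      + (h * c * blockConst S h c * S.b k / S.a k + 2 * blockConst S h c ^ 2) *
        (h * ∑ l ∈ Finset.range h, ‖S.res ω (k + l : ℕ)‖ ^ 2)
      + (h * ∑ l ∈ Finset.range h, ‖S.delayRes ω (k + l)‖ ^ 2) / (S.a k * S.b k) := by
  have hc : 0 ≤ c := zero_le_one.trans hS.one_le
  filter_upwards [hS.norm_blockRem_le, hS.norm_err_add_sub_le_blockConst] with ω h1 h2 k
  have ha := hS.a_pos k
  have hb := hS.b_pos k
  have hb0 := hS.b_pos 0
  have hC : 0 ≤ blockConst S h c := by rw [blockConst]; positivity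
  have h3 := two_mul_add_sq_le ha hb (norm_nonneg (S.err ω k))
    (norm_nonneg (S.err ω (k + h : ℕ) - S.err ω k))
    (show 0 ≤ h * c * blockConst S h c by positivity) (h1 k) (h2 k h le_rfl)
  have h4 : ‖S.err ω (k + h : ℕ)‖ ^ 2 = ‖S.err ω k‖ ^ 2
      + 2 * inner ℝ (S.err ω k) (S.err ω (k + h : ℕ) - S.err ω k)
      + ‖S.err ω (k + h : ℕ) - S.err ω k‖ ^ 2 := by
    rw [← norm_add_sq_real, add_sub_cancel]
  have h5 : inner ℝ (S.err ω k) (S.err ω (k + h : ℕ) - S.err ω k)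
      = - ∑ l ∈ Finset.range h, inner ℝ (S.err ω k) (act (S.Gmat (k + l) ω (S.F ω)) (S.err ω k))
        + ∑ l ∈ Finset.range h, S.a (k + l) * inner ℝ (S.err ω k) (S.obsNoise (k + l) ω)
        + inner ℝ (S.err ω k) (blockRem S ω k h) := by
    rw [err_add_eq]
    simp only [inner_sub_right, inner_add_right, inner_sum, inner_smul_right]
    ring
  have h6 := real_inner_le_norm (S.err ω k) (blockRem S ω k h)
  have h7 : (∑ l ∈ Finset.range h, ‖S.res ω (k + l : ℕ)‖) ^ 2
      ≤ h * ∑ l ∈ Finset.range h, ‖S.res ω (k + l : ℕ)‖ ^ 2 := by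
    simpa using sq_sum_le_card_mul_sum_sq (s := Finset.range h)
      (f := fun l => ‖S.res ω (k + l : ℕ)‖)
  have h8 : (∑ l ∈ Finset.range h, ‖S.delayRes ω (k + l)‖) ^ 2
      ≤ h * ∑ l ∈ Finset.range h, ‖S.delayRes ω (k + l)‖ ^ 2 := by
    simpa using sq_sum_le_card_mul_sum_sq (s := Finset.range h)
      (f := fun l => ‖S.delayRes ω (k + l)‖)
  have h9 := mul_le_mul_of_nonneg_left h7 (show 0 ≤ h * c * blockConst S h c * S.b k / S.a k
    + 2 * blockConst S h c ^ 2 by positivity)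
  have h10 := div_le_div_of_nonneg_right h8 (mul_pos ha hb).le
  rw [h4, h5, growth]
  linarith

/-- The mean square error. -/
noncomputable def mse (S : Network μ N n d p) (k : ℕ) : ℝ := ∫ ω, ‖S.err ω k‖ ^ 2 ∂μ

variable [IsProbabilityMeasure μ]

theorem integrable_inner_Gmat (hS : S.Regular h c) (k l : ℕ) :
    Integrable (fun ω => inner ℝ (S.err ω k) (act (S.Gmat l ω (S.F ω)) (S.err ω k))) μ :=
  integrable_inner_of_memLp (hS.memLp_err k) (hS.memLp_act_Gmat l (measurable_err' k) (hS.memLp_err k))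

/-- Since e(mh) is measurable for the conditioning field, each matrix in the quadratic form may be
replaced by its conditional expectation, where the pointwise drift bound applies. -/
theorem mul_mse_le_sum (hS : S.Regular h c)
    (hlam : ∀ᵐ ω ∂μ, ∀ m : ℕ, θ ≤ S.lam h m ω - S.Delta h m ω) (m : ℕ) :
    θ * mse S (m * h) ≤ ∑ k ∈ Finset.Ico (m * h) ((m + 1) * h),
      (∫ ω, inner ℝ (S.err ω (m * h : ℕ))
        (act (S.Gmat k ω (S.F ω)) (S.err ω (m * h : ℕ))) ∂μ) / S.a k := by
  set x : Ω → EuclideanSpace ℝ (Fin N × Fin n) := fun ω => S.err ω (m * h : ℕ) with hx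
  have hx2 : MemLp x 2 μ := hS.memLp_err _
  have hxm : Measurable[S.past (m * h)] x := by
    have := S.measurable_err (m * h : ℕ)
    rwa [Int.toNat_natCast] at this
  have hpast := S.past_le (m * h)
  have hA := fun k => integral_inner_act_eq_condExpMat hpast hx2 hxm
    (M := fun ω => S.laplSym k ω ⊗ₖ (1 : Matrix (Fin n) (Fin n) ℝ)) (C := c)
    ((S.measMat_laplSym k).mono (S.sigmaSystem_le k)).kronecker_one
    (hS.entry_laplSym.mono fun ω hω i j => hω k i j)
  have hH := fun k => integral_inner_act_eq_condExpMat hpast hx2 hxm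
    (M := fun ω => (S.Hdiag k ω)ᵀ * S.Hdiag k ω) (C := c * c)
    (((S.measMat_Hdiag k).mono (S.sigmaSystem_le k)).transpose.mul
      ((S.measMat_Hdiag k).mono (S.sigmaSystem_le k)))
    (hS.norm_Hdiag.mono fun ω hω i j => by
      refine (abs_entry_le_norm _ i j).trans ((Matrix.l2_opNorm_mul _ _).trans ?_)
      rw [norm_transpose_eq]
      exact mul_le_mul (hω k) (hω k) (norm_nonneg _) (zero_le_one.trans hS.one_le))
  have hB := fun (k : ℕ) (q : ℕ) (hq : q ∈ Finset.range (d + 1)) =>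
    integral_inner_act_eq_condExpMat hpast hx2 hxm
    (M := fun ω => S.Abar k q ω * ((transProd (S.F ω) ((k : ℤ) - 1) ((k : ℤ) - q))⁻¹ - 1)) (C := c)
    (((S.measMat_Abar k q).mono (S.sigmaSystem_le k)).mul ((MeasMat.transProd fun t _ =>
      (S.measMat_F t).mono (S.past_le _)).inv.sub (MeasMat.const 1)))
    (hS.entry_Abar.mono fun ω hω i j => hω k q i j (Nat.lt_succ_iff.1 (Finset.mem_range.1 hq)))
  have hint := fun k => integral_mul_add_sub_mul_sum (hA k).2.1 (hH k).2.1
    (fun q hq => (hB k q hq).2.1) (S.b k / S.a k)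
  have e : ∀ k, (∫ ω, inner ℝ (x ω) (act (S.Gmat k ω (S.F ω)) (x ω)) ∂μ) / S.a k
      = ∫ ω, (S.b k / S.a k * inner ℝ (x ω) (act (condExpMat μ (S.past (m * h))
          (fun ω' => S.laplSym k ω' ⊗ₖ (1 : Matrix (Fin n) (Fin n) ℝ)) ω) (x ω))
        + inner ℝ (x ω) (act (condExpMat μ (S.past (m * h))
          (fun ω' => (S.Hdiag k ω')ᵀ * S.Hdiag k ω') ω) (x ω))
        - S.b k / S.a k * ∑ q ∈ Finset.range (d + 1), inner ℝ (x ω) (act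
          (condExpMat μ (S.past (m * h)) (fun ω' => S.Abar k q ω' *
            ((transProd (S.F ω') ((k : ℤ) - 1) ((k : ℤ) - q))⁻¹ - 1)) ω) (x ω))) ∂μ := by
    intro k
    rw [← integral_div]
    simp only [inner_act_Gmat hS.a_pos]
    rw [(integral_mul_add_sub_mul_sum (hA k).1 (hH k).1 (fun q hq => (hB k q hq).1) _).2,
      (hint k).2, (hA k).2.2, (hH k).2.2, Finset.sum_congr rfl fun q hq => (hB k q hq).2.2]
  rw [Finset.sum_congr rfl fun k _ => e k, ← integral_finsetSum _ fun k _ => (hint k).1, mse,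
    ← integral_const_mul]
  refine integral_mono_ae ((integrable_norm_sq hx2).const_mul θ)
    (integrable_finsetSum _ fun k _ => (hint k).1) ?_
  filter_upwards [hlam] with ω hω
  exact mul_norm_sq_le_drift (hω m) hS.a_pos hS.b_pos (x ω)

/-- The drift over a block, up to the variation of the gains. -/
theorem drift_le (hS : S.Regular h c)
    (hlam : ∀ᵐ ω ∂μ, ∀ m : ℕ, θ ≤ S.lam h m ω - S.Delta h m ω) (m : ℕ) :
    (θ * S.a (m * h) - 2 * h * c ^ 3 * (√(S.a (m * h)) - √(S.a ((m + 1) * h)))) * mse S (m * h)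
      ≤ ∑ l ∈ Finset.range h, ∫ ω, inner ℝ (S.err ω (m * h : ℕ))
        (act (S.Gmat (m * h + l) ω (S.F ω)) (S.err ω (m * h : ℕ))) ∂μ := by
  have hc : 0 ≤ c := zero_le_one.trans hS.one_le
  have hV : 0 ≤ mse S (m * h) := integral_nonneg fun ω => sq_nonneg _
  have h1 := hS.mul_mse_le_sum hlam m
  rw [Finset.sum_Ico_eq_sum_range, show (m + 1) * h - m * h = h by rw [add_mul]; omega] at h1
  set g : ℕ → ℝ := fun l => ∫ ω, inner ℝ (S.err ω (m * h : ℕ))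
        (act (S.Gmat (m * h + l) ω (S.F ω)) (S.err ω (m * h : ℕ))) ∂μ with hg
  have hgl : ∀ l, |g l| ≤ c * S.b (m * h + l) * mse S (m * h) := by
    intro l
    rw [mse, ← integral_const_mul]
    refine abs_integral_le_integral_abs.trans (integral_mono_ae
      (hS.integrable_inner_Gmat _ _).abs ((integrable_norm_sq (hS.memLp_err _)).const_mul _) ?_)
    filter_upwards [hS.norm_Gmat] with ω hω
    refine (abs_inner_act_le _ _).trans ?_
    exact mul_le_mul_of_nonneg_right (hω _) (sq_nonneg _)
  -- Each term comes divided by its own gain. Exchanging it for a(mh) costs at most (a(mh)/a(mh+l) −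
  -- 1)|g l|; since g l is O(b) times the mean square error, this is a difference of square roots of
  -- gains.
  have h2 : ∀ l ∈ Finset.range h, S.a (m * h) * (g l / S.a (m * h + l))
      - 2 * c ^ 3 * (√(S.a (m * h)) - √(S.a ((m + 1) * h))) * mse S (m * h) ≤ g l := by
    intro l hl
    have hl' := Finset.mem_range.1 hl
    have h3 := div_sub_one_mul_le (hS.a_pos ((m + 1) * h))
      (hS.a_anti (show m * h + l ≤ (m + 1) * h by rw [add_mul]; omega))
      (hS.a_anti (Nat.le_add_right (m * h) l)) hS.one_le
      (by rw [add_mul, one_mul]; exact hS.a_ratio _ _ (by omega)) (hS.b_pos (m * h + l)).le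
      ((pow_le_pow_left₀ (hS.b_pos _).le (hS.b_anti (Nat.le_add_right (m * h) l)) 2).trans
        (hS.b_sq_le _))
    have h4 : 0 ≤ S.a (m * h) / S.a (m * h + l) - 1 := by
      rw [sub_nonneg, one_le_div (hS.a_pos _)]
      exact hS.a_anti (Nat.le_add_right _ _)
    have h5 : (S.a (m * h) / S.a (m * h + l) - 1) * g l
        ≤ (S.a (m * h) / S.a (m * h + l) - 1) * (c * S.b (m * h + l) * mse S (m * h)) :=
      mul_le_mul_of_nonneg_left ((le_abs_self _).trans (hgl l)) h4
    have h6 := mul_le_mul_of_nonneg_right h3 (mul_nonneg hc hV)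
    have e : S.a (m * h) * (g l / S.a (m * h + l)) = S.a (m * h) / S.a (m * h + l) * g l := by
      ring
    rw [e]
    linarith
  have h7 := Finset.sum_le_sum h2
  rw [Finset.sum_sub_distrib, ← Finset.mul_sum, Finset.sum_const, Finset.card_range,
    nsmul_eq_mul] at h7
  have h8 := mul_le_mul_of_nonneg_left h1 (hS.a_pos (m * h)).le
  linarith

end Regular
end Network

/-! ### The mean square recursion over blocks and its convergence. -/

namespace Network

variable {Ω : Type*} [mΩ : MeasurableSpace Ω] {μ : Measure Ω} {N n d : ℕ} {p : Fin N → ℕ}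
  {S : Network μ N n d p} {h : ℕ} {c θ : ℝ}

namespace Regular

theorem blockConst_nonneg (hS : S.Regular h c) : 0 ≤ blockConst S h c := by
  have hc : 0 ≤ c := zero_le_one.trans hS.one_le
  have hb0 := hS.b_pos 0
  rw [blockConst]
  positivity

/-- The growth factor is O(b²) + O(ab), hence o(a). The bound θa is half of the drift 2θa, so the
other half survives. -/
theorem eventually_growth_le (hS : S.Regular h c) (hθ : 0 < θ) :
    ∀ᶠ k in atTop, growth S h c k ≤ θ * S.a k := by
  have hc : 0 ≤ c := zero_le_one.trans hS.one_le
  have hC := hS.blockConst_nonneg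
  set A := 2 * (h * c * blockConst S h c) + 2 * blockConst S h c ^ 2 with hA
  set B := h * c * blockConst S h c + 1 with hB
  have hA0 : 0 ≤ A := by positivity
  have h1 := hS.b_sq_isLittleO.bound (show 0 < θ / (2 * (A + 1)) by positivity)
  have h2 : Tendsto (fun k => B * S.b k) atTop (𝓝 0) := by simpa using hS.b_lim.const_mul B
  filter_upwards [h1, h2.eventually_le_const (half_pos hθ)] with k e1 e2
  have ha := hS.a_pos k
  have hb := hS.b_pos k
  rw [Real.norm_of_nonneg (by positivity), Real.norm_of_nonneg ha.le] at e1
  have e3 : A * S.b k ^ 2 ≤ θ / 2 * S.a k := by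
    calc A * S.b k ^ 2 ≤ (A + 1) * (θ / (2 * (A + 1)) * S.a k) := by
          refine mul_le_mul (by linarith) e1 (by positivity) (by positivity)
      _ = θ / 2 * S.a k := by field_simp
  have e4 := mul_le_mul_of_nonneg_right e2 ha.le
  have e : growth S h c k = A * S.b k ^ 2 + B * S.b k * S.a k := by
    rw [growth, hA, hB]; ring
  rw [e]
  linarith

theorem mse_nonneg (k : ℕ) : 0 ≤ mse S k := integral_nonneg fun _ => sq_nonneg _

variable [IsProbabilityMeasure μ]

theorem integral_sum_res_le (hS : S.Regular h c) {K : ℝ} (hK0 : 0 ≤ K)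
    (hK : ∀ k : ℕ, ∫ ω, ‖S.res ω k‖ ^ 2 ∂μ ≤ K * S.a k ^ 2) (k : ℕ) :
    ∫ ω, ∑ l ∈ Finset.range h, ‖S.res ω (k + l : ℕ)‖ ^ 2 ∂μ ≤ h * (K * S.a k ^ 2) := by
  rw [integral_finsetSum _ fun l _ => integrable_norm_sq (hS.memLp_res _)]
  calc _ ≤ ∑ _l ∈ Finset.range h, K * S.a k ^ 2 := by
        refine Finset.sum_le_sum fun l _ => (hK _).trans ?_
        have := (hS.a_pos (k + l)).le
        gcongr
        exact hS.a_anti (Nat.le_add_right _ _)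
    _ = _ := by simp

/-- The mean square recursion over a block. -/
theorem mse_add_le (hS : S.Regular h c) {K : ℝ} (hK0 : 0 ≤ K)
    (hK : ∀ k : ℕ, ∫ ω, ‖S.res ω k‖ ^ 2 ∂μ ≤ K * S.a k ^ 2)
    (hK' : ∀ k : ℕ, d ≤ k → ∫ ω, ‖S.delayRes ω k‖ ^ 2 ∂μ ≤ K * (S.a k * S.b k) ^ 2)
    {k : ℕ} (hk : d ≤ k) :
    mse S (k + h) ≤ (1 + growth S h c k) * mse S k
      - 2 * ∑ l ∈ Finset.range h,
        ∫ ω, inner ℝ (S.err ω k) (act (S.Gmat (k + l) ω (S.F ω)) (S.err ω k)) ∂μ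
      + h ^ 2 * K * (h * c * blockConst S h c * S.b k + 2 * blockConst S h c ^ 2 * S.a k + S.b k)
        * S.a k := by
  have hc : 0 ≤ c := zero_le_one.trans hS.one_le
  have hC := hS.blockConst_nonneg
  have ha := hS.a_pos k
  have hb := hS.b_pos k
  have hx : Measurable[S.past k] fun ω => S.err ω k := by
    have := S.measurable_err k
    rwa [Int.toNat_natCast] at this
  have i1 : Integrable (fun ω => (1 + growth S h c k) * ‖S.err ω k‖ ^ 2) μ :=
    (integrable_norm_sq (hS.memLp_err k)).const_mul _
  have i2 : Integrable (fun ω => 2 * ∑ l ∈ Finset.range h,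
      inner ℝ (S.err ω k) (act (S.Gmat (k + l) ω (S.F ω)) (S.err ω k))) μ :=
    (integrable_finsetSum _ fun l _ => hS.integrable_inner_Gmat k (k + l)).const_mul _
  have i3' : ∀ l, Integrable (fun ω => S.a (k + l) *
      inner ℝ (S.err ω k) (S.obsNoise (k + l) ω)) μ := fun l =>
    (integrable_inner_of_memLp (hS.memLp_err k) (hS.memLp_obsNoise (k + l))).const_mul _
  have i3 : Integrable (fun ω => 2 * ∑ l ∈ Finset.range h, S.a (k + l) *
      inner ℝ (S.err ω k) (S.obsNoise (k + l) ω)) μ :=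
    (integrable_finsetSum _ fun l _ => i3' l).const_mul _
  have i4 : Integrable (fun ω => (h * c * blockConst S h c * S.b k / S.a k
      + 2 * blockConst S h c ^ 2) * (h * ∑ l ∈ Finset.range h, ‖S.res ω (k + l : ℕ)‖ ^ 2)) μ :=
    ((integrable_finsetSum _ fun l _ => integrable_norm_sq (hS.memLp_res _)).const_mul _).const_mul _
  have i5 : Integrable (fun ω => (h * ∑ l ∈ Finset.range h, ‖S.delayRes ω (k + l)‖ ^ 2)
      / (S.a k * S.b k)) μ :=
    ((integrable_finsetSum _ fun l _ =>
      integrable_norm_sq (hS.memLp_delayRes _)).const_mul _).div_const _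
  have i12 := i1.sub i2
  have i123 := i12.add i3
  have i1234 := i123.add i4
  have h1 : mse S (k + h) ≤ _ := integral_mono_ae (integrable_norm_sq (hS.memLp_err (k + h)))
    (i1234.add i5) (hS.norm_err_add_sq_le.mono fun ω hω => hω k)
  rw [integral_add' i1234 i5, integral_add' i123 i4, integral_add' i12 i3, integral_sub' i1 i2,
    integral_const_mul, integral_const_mul, integral_const_mul, integral_const_mul,
    integral_div, integral_const_mul, integral_const_mul,
    integral_finsetSum _ fun l _ => hS.integrable_inner_Gmat k (k + l),
    integral_finsetSum _ fun l _ => i3' l] at h1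
  have h3 : ∑ l ∈ Finset.range h, ∫ ω, S.a (k + l) *
      inner ℝ (S.err ω k) (S.obsNoise (k + l) ω) ∂μ = 0 := by
    refine Finset.sum_eq_zero fun l _ => ?_
    rw [integral_const_mul, integral_inner_obsNoise_eq_zero hS.indep hS.memLp_v hS.condExp_v
      (Nat.le_add_right k l) (hS.norm_Hdiag.mono fun ω hω => hω _) hx (hS.memLp_err k), mul_zero]
  have h4 := hS.integral_sum_res_le hK0 hK k
  have h5 : ∫ ω, ∑ l ∈ Finset.range h, ‖S.delayRes ω (k + l)‖ ^ 2 ∂μ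
      ≤ h * (K * (S.a k * S.b k) ^ 2) := by
    rw [integral_finsetSum _ fun l _ => integrable_norm_sq (hS.memLp_delayRes _)]
    calc _ ≤ ∑ _l ∈ Finset.range h, K * (S.a k * S.b k) ^ 2 := by
          refine Finset.sum_le_sum fun l _ => (hK' _ (by omega)).trans ?_
          have ha' := (hS.a_pos (k + l)).le
          have hb' := (hS.b_pos (k + l)).le
          gcongr
          · exact hS.a_anti (Nat.le_add_right _ _)
          · exact hS.b_anti (Nat.le_add_right _ _)
      _ = _ := by simp
  -- The moment bounds a² here and (ab)² in `h7` cancel the denominators a and ab left by Young's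
  -- inequality.
  have h6 : (h * c * blockConst S h c * S.b k / S.a k + 2 * blockConst S h c ^ 2) *
      (h * ∫ ω, ∑ l ∈ Finset.range h, ‖S.res ω (k + l : ℕ)‖ ^ 2 ∂μ)
      ≤ h ^ 2 * K * (h * c * blockConst S h c * S.b k + 2 * blockConst S h c ^ 2 * S.a k)
        * S.a k := by
    calc _ ≤ (h * c * blockConst S h c * S.b k / S.a k + 2 * blockConst S h c ^ 2) *
          (h * (h * (K * S.a k ^ 2))) := by gcongr
      _ = _ := by field_simp
  have h7 : (h * ∫ ω, ∑ l ∈ Finset.range h, ‖S.delayRes ω (k + l)‖ ^ 2 ∂μ) / (S.a k * S.b k)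
      ≤ h ^ 2 * K * S.b k * S.a k := by
    calc _ ≤ (h * (h * (K * (S.a k * S.b k) ^ 2))) / (S.a k * S.b k) := by gcongr
      _ = _ := by field_simp
  rw [h3] at h1
  change mse S (k + h) ≤ (1 + growth S h c k) * mse S k - _ + _ + _ + _ at h1
  linarith

theorem tendsto_mse_sample (hS : S.Regular h c) (hh : 0 < h) (hθ : 0 < θ)
    (hlam : ∀ᵐ ω ∂μ, ∀ m : ℕ, θ ≤ S.lam h m ω - S.Delta h m ω) :
    Tendsto (fun m => mse S (m * h)) atTop (𝓝 0) := by
  obtain ⟨K, hK0, hK, hK'⟩ := hS.exists_integral_res_le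
  have hc : 0 ≤ c := zero_le_one.trans hS.one_le
  have hmul : Tendsto (fun m : ℕ => m * h) atTop atTop := tendsto_id.atTop_mul_const' hh
  have ha := hS.a_lim.comp hmul
  have hb := hS.b_lim.comp hmul
  have hs0 : Antitone fun m => √(S.a (m * h)) := fun m m' hm =>
    Real.sqrt_le_sqrt (hS.a_anti (Nat.mul_le_mul_right h hm))
  -- The drift enters the squared norm doubled: of 2θa, one θa compensates the growth factor and the
  -- other is α, and the gain variation 2hc³(√a − √a′) becomes ε with the constant 4.
  refine tendsto_zero_of_gain_recursion_of_summable (α := fun m => θ * S.a (m * h))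
    (ε := fun m => 4 * h * c ^ 3 * (√(S.a (m * h)) - √(S.a ((m + 1) * h))))
    (ζ := fun m => h ^ 2 * K * (h * c * blockConst S h c * S.b (m * h)
      + 2 * blockConst S h c ^ 2 * S.a (m * h) + S.b (m * h)) / θ)
    (fun m => mse_nonneg _) (fun m => mul_nonneg hθ.le (hS.a_pos _).le) ?_ ?_ ?_ ?_ ?_ ?_
  · simpa using ha.const_mul θ
  · simp only [← Finset.mul_sum]
    exact (tendsto_sum_sample_atTop hS.a_anti hh hS.a_sum).const_mul_atTop hθ
  · intro m
    exact mul_nonneg (by positivity) (sub_nonneg.2 (hs0 (Nat.le_succ m)))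
  · exact (summable_sub_of_antitone hs0 fun m => Real.sqrt_nonneg _).mul_left _
  · have := ((((hb.const_mul (h * c * blockConst S h c)).add
      (ha.const_mul (2 * blockConst S h c ^ 2))).add hb).const_mul (h ^ 2 * K)).div_const θ
    simpa using this
  · filter_upwards [hmul.eventually (hS.eventually_growth_le hθ),
      hmul.eventually (eventually_ge_atTop d)] with m h1 h2
    have h3 := hS.mse_add_le hK0 hK hK' h2
    have h4 := hS.drift_le hlam m
    have h5 := mul_le_mul_of_nonneg_right h1 (mse_nonneg (S := S) (m * h))
    rw [show (m + 1) * h = m * h + h by ring] at h4 ⊢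
    have e : h ^ 2 * K * (h * c * blockConst S h c * S.b (m * h)
        + 2 * blockConst S h c ^ 2 * S.a (m * h) + S.b (m * h)) / θ * (θ * S.a (m * h))
        = h ^ 2 * K * (h * c * blockConst S h c * S.b (m * h)
        + 2 * blockConst S h c ^ 2 * S.a (m * h) + S.b (m * h)) * S.a (m * h) := by
      field_simp
    rw [e]
    linarith

/-- Within a block the mean square error exceeds a fixed multiple of its initial value by at most
O(a²), so convergence along multiples of h is enough. -/
theorem tendsto_mse (hS : S.Regular h c) (hh : 0 < h) (hθ : 0 < θ)
    (hlam : ∀ᵐ ω ∂μ, ∀ m : ℕ, θ ≤ S.lam h m ω - S.Delta h m ω) :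
    Tendsto (fun k => mse S k) atTop (𝓝 0) := by
  obtain ⟨K, hK0, hK, -⟩ := hS.exists_integral_res_le
  set B := blockConst S h c with hB
  have hbound : ∀ k j, j ≤ h → mse S (k + j)
      ≤ (2 + 4 * B ^ 2 * S.b 0 ^ 2) * mse S k + 4 * B ^ 2 * (h * (h * (K * S.a k ^ 2))) := by
    intro k j hj
    have i1 : Integrable (fun ω => (2 + 4 * B ^ 2 * S.b 0 ^ 2) * ‖S.err ω k‖ ^ 2) μ :=
      (integrable_norm_sq (hS.memLp_err k)).const_mul _
    have i2 : Integrable (fun ω => 4 * B ^ 2 * (h * ∑ l ∈ Finset.range h,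
        ‖S.res ω (k + l : ℕ)‖ ^ 2)) μ :=
      ((integrable_finsetSum _ fun l _ =>
        integrable_norm_sq (hS.memLp_res _)).const_mul _).const_mul _
    have h1 : mse S (k + j) ≤ _ := integral_mono_ae (integrable_norm_sq (hS.memLp_err (k + j)))
      (i1.add i2) (hS.norm_err_add_sub_le_blockConst.mono fun ω hω => by
        have h2 := hω k j hj
        have h3 : (∑ l ∈ Finset.range h, ‖S.res ω (k + l : ℕ)‖) ^ 2
            ≤ h * ∑ l ∈ Finset.range h, ‖S.res ω (k + l : ℕ)‖ ^ 2 := by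
          simpa using sq_sum_le_card_mul_sum_sq (s := Finset.range h)
            (f := fun l => ‖S.res ω (k + l : ℕ)‖)
        have h4 : ‖S.err ω (k + j : ℕ)‖
            ≤ ‖S.err ω k‖ + ‖S.err ω (k + j : ℕ) - S.err ω k‖ := by
          simpa using norm_add_le (S.err ω k) (S.err ω (k + j : ℕ) - S.err ω k)
        have h5 : S.b k ^ 2 ≤ S.b 0 ^ 2 :=
          pow_le_pow_left₀ (hS.b_pos k).le (hS.b_anti (Nat.zero_le _)) 2
        set X := ‖S.err ω k‖
        set D := ‖S.err ω (k + j : ℕ) - S.err ω k‖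
        set R := ∑ l ∈ Finset.range h, ‖S.res ω (k + l : ℕ)‖
        have h6 : ‖S.err ω (k + j : ℕ)‖ ^ 2 ≤ 2 * X ^ 2 + 2 * D ^ 2 := by
          calc _ ≤ (X + D) ^ 2 := pow_le_pow_left₀ (norm_nonneg _) h4 2
            _ ≤ _ := by nlinarith [sq_nonneg (X - D)]
        have h7 : D ^ 2 ≤ B ^ 2 * (2 * (S.b k ^ 2 * X ^ 2) + 2 * R ^ 2) := by
          calc D ^ 2 ≤ (B * (S.b k * X + R)) ^ 2 := pow_le_pow_left₀ (norm_nonneg _) h2 2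
            _ ≤ _ := by nlinarith [mul_nonneg (sq_nonneg B) (sq_nonneg (S.b k * X - R))]
        have h8 := mul_le_mul_of_nonneg_left (mul_le_mul_of_nonneg_right h5 (sq_nonneg X))
          (sq_nonneg B)
        have h9 := mul_le_mul_of_nonneg_left h3 (sq_nonneg B)
        change _ ≤ (2 + 4 * B ^ 2 * S.b 0 ^ 2) * X ^ 2 + 4 * B ^ 2 * (h * _)
        linarith)
    rw [integral_add' i1 i2, integral_const_mul, integral_const_mul, integral_const_mul] at h1
    refine h1.trans (add_le_add_right ?_ _)
    have := hS.integral_sum_res_le hK0 hK k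
    gcongr
  have hdiv : Tendsto (fun k : ℕ => k / h) atTop atTop := Nat.tendsto_div_const_atTop hh.ne'
  have hmul : Tendsto (fun m : ℕ => m * h) atTop atTop := tendsto_id.atTop_mul_const' hh
  have hlim : Tendsto (fun m : ℕ => (2 + 4 * B ^ 2 * S.b 0 ^ 2) * mse S (m * h)
      + 4 * B ^ 2 * (h * (h * (K * S.a (m * h) ^ 2)))) atTop (𝓝 0) := by
    have h1 := (hS.tendsto_mse_sample hh hθ hlam).const_mul (2 + 4 * B ^ 2 * S.b 0 ^ 2)
    have h2 := (((((hS.a_lim.comp hmul).pow 2).const_mul K).const_mul (h : ℝ)).const_mul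
      (h : ℝ)).const_mul (4 * B ^ 2)
    simpa using h1.add h2
  refine squeeze_zero (fun k => mse_nonneg k) (fun k => ?_) (hlim.comp hdiv)
  have h1 := hbound (k / h * h) (k % h) (Nat.mod_lt k hh).le
  rwa [Nat.div_add_mod'] at h1

theorem convergesInMeanSquare (hS : S.Regular h c) (hh : 0 < h) (hθ : 0 < θ)
    (hlam : ∀ᵐ ω ∂μ, ∀ m : ℕ, θ ≤ S.lam h m ω - S.Delta h m ω) : S.ConvergesInMeanSquare := by
  intro i
  have hle : ∀ (k : ℕ) ω, ‖S.estimate ω k i - S.x₀‖ ^ 2 ≤ ‖S.err ω k‖ ^ 2 := by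
    intro k ω
    rw [EuclideanSpace.norm_sq_eq, EuclideanSpace.norm_sq_eq, Fintype.sum_prod_type]
    exact Finset.single_le_sum (f := fun i => ∑ c, ‖S.err ω k (i, c)‖ ^ 2)
      (fun i _ => Finset.sum_nonneg fun c _ => sq_nonneg _) (Finset.mem_univ i)
  have hint : ∀ k : ℕ, Integrable (fun ω => ‖S.estimate ω k i - S.x₀‖ ^ 2) μ := by
    intro k
    have hm : Measurable fun ω => S.estimate ω k i - S.x₀ := by
      refine (WithLp.measurable_toLp 2 (Fin n → ℝ)).comp (measurable_pi_lambda
        (fun ω c => S.err ω k (i, c)) fun c => ?_)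
      exact (measurable_pi_apply (i, c)).comp ((WithLp.measurable_ofLp 2 _).comp
        (measurable_err' k))
    refine (integrable_norm_sq (hS.memLp_err k)).mono' (hm.norm.pow_const 2).aestronglyMeasurable
      (Eventually.of_forall fun ω => ?_)
    rw [Real.norm_of_nonneg (sq_nonneg _)]
    exact hle k ω
  refine ⟨hint, squeeze_zero (fun k => integral_nonneg fun ω => sq_nonneg _) (fun k => ?_)
    (hS.tendsto_mse hh hθ hlam)⟩
  exact integral_mono (hint k) (integrable_norm_sq (hS.memLp_err k)) (hle k)

end Regular

variable [IsProbabilityMeasure μ]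

/-- The assumptions of the convergence theorem imply regularity. -/
theorem exists_regular {βa βH Ca : ℝ} (hN : 0 < N) (hindep : S.NoiseIndep)
    (hnoise : S.NoiseMartingaleDiff) (hbdd : S.BoundedBy βa βH) (hgains : S.GainsDecay)
    (hsmall : S.GainsSmall βa βH Ca) (hh : 0 < h) : ∃ c, S.Regular h c := by
  obtain ⟨hv, hmds, βv, hβv, hv2⟩ := hnoise
  obtain ⟨hβa, hβH, hadj, hH⟩ := hbdd
  obtain ⟨ha, hb, ha_anti, hb_anti, ha_lim, hb_lim, -, hratio, hbo, hsum⟩ := hgains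
  obtain ⟨hab, hsup⟩ := hsmall
  have : Nonempty (Set.Ioo (0 : ℝ) 1) := ⟨⟨1 / 2, by norm_num, by norm_num⟩⟩
  -- The strict inequality between suprema yields one κ that works for all times.
  obtain ⟨⟨κ, hκ0, hκ1⟩, hκ⟩ := exists_lt_of_lt_ciSup hsup
  have hbdd_b : BddAbove (Set.range S.b) := ⟨S.b 0, by
    rintro _ ⟨k, rfl⟩
    exact hb_anti (Nat.zero_le k)⟩
  have hbκ := fun k => (le_ciSup hbdd_b k).trans_lt hκ
  have hCa : 0 ≤ Ca := (pos_of_mul_pos_left ((ha 0).trans_le (hab 0)) (hb 0).le).le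
  -- Because a never vanishes, asymptotic bounds hold at all times after enlarging the constant. The
  -- ratio bound at lag d + h covers all shorter lags by monotonicity.
  obtain ⟨c₁, hc₁, hc₁b⟩ := bound_of_isBigO_nat_atTop hbo.isBigO
  obtain ⟨c₂, hc₂, hc₂b⟩ := bound_of_isBigO_nat_atTop (hratio (d + h) (by omega))
  set ρ := (1 - κ)⁻¹ with hρ
  have hρ1 : 1 ≤ ρ := (one_le_inv₀ (by linarith)).2 (by linarith)
  have hρ0 : 0 ≤ ρ := zero_le_one.trans hρ1
  have hgeom : 0 ≤ ∑ q ∈ Finset.range (d + 1), ρ ^ q := Finset.sum_nonneg fun q _ => by positivity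
  set c₃ := N * βa + Ca * βH ^ 2 + N * βa * ∑ q ∈ Finset.range (d + 1), ρ ^ q with hc₃
  set c₄ := (d + 1) * (N * βa) * ρ ^ d with hc₄
  set c₅ := N * βa + βa with hc₅
  set c₆ := N * βa * (ρ ^ d + 1) with hc₆
  have h3 : 0 ≤ c₃ := by positivity
  have h4 : 0 ≤ c₄ := by positivity
  have h5 : 0 ≤ c₅ := by positivity
  have h6 : 0 ≤ c₆ := by positivity
  have htraj : ∀ᵐ ω ∂μ, (∀ k i j, |S.adj k ω i j| ≤ βa) ∧ (∀ k i, ‖S.H k i ω‖ ≤ βH) ∧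
      ∀ t, IsUnit (S.F ω t).det ∧ ∀ x, ‖act (S.F ω t)⁻¹ x‖ ≤ ρ * ‖x‖ := by
    filter_upwards [hadj, hH] with ω h1 h2
    exact ⟨h1, h2, S.isUnit_F_and_norm_inv_le hN hκ1 hκ0 hβa hβH.le ha hb hab h1 h2 hbκ⟩
  refine ⟨1 + βv + βH + c₁ + c₂ + c₃ + c₄ + c₅ + c₆, by linarith, ha, hb, ha_anti, hb_anti, ha_lim,
    hb_lim, hsum, fun k => ?_, hbo, fun k j hj => ?_, hv, hmds, fun k => ?_, hindep, ?_, ?_, ?_,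
    ?_, ?_⟩
  · have := hc₁b (x := k) (ha k).ne'
    rw [Real.norm_of_nonneg (sq_nonneg _), Real.norm_of_nonneg (ha k).le] at this
    exact this.trans (mul_le_mul_of_nonneg_right (by linarith) (ha k).le)
  · have := hc₂b (x := k) (ha (k + (d + h))).ne'
    rw [Real.norm_of_nonneg (ha _).le, Real.norm_of_nonneg (ha _).le] at this
    refine this.trans (mul_le_mul (by linarith) (ha_anti (by omega)) (ha _).le (by linarith))
  · have h1 : ∫ ω, ‖S.v k ω‖ ^ 2 ∂μ ≤ βv := by
      rw [← integral_condExp (S.past_le k)]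
      calc _ ≤ ∫ _ω, βv ∂μ := integral_mono_ae integrable_condExp (integrable_const _) (hv2 k)
        _ = βv := by simp
    linarith
  · filter_upwards [htraj] with ω ⟨e1, e2, e3⟩ k
    have h1 := S.norm_Gmat_le hρ0 hβa.le hβH.le (ha k).le (hb k).le (e1 k) (e2 k)
      fun t _ => (e3 t).2
    have h2 := mul_le_mul_of_nonneg_right (hab k) (sq_nonneg βH)
    calc _ ≤ c₃ * S.b k := by rw [hc₃]; linarith
      _ ≤ _ := mul_le_mul_of_nonneg_right (by linarith) (hb k).le
  · filter_upwards [htraj] with ω ⟨e1, e2, e3⟩ k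
    have := S.norm_Hdiag_le hβH.le (e2 k)
    linarith
  · filter_upwards [htraj] with ω ⟨e1, e2, e3⟩ k
    refine (S.norm_delayRes_le hρ1 hβa.le (hb k).le (e1 k) e3).trans ?_
    refine mul_le_mul_of_nonneg_right (mul_le_mul_of_nonneg_right ?_ (hb k).le)
      (Finset.sum_nonneg fun _ _ => norm_nonneg _)
    linarith
  · filter_upwards [htraj] with ω ⟨e1, e2, e3⟩ k i j
    have hdeg : ∀ i j, |S.degMat k ω i j| ≤ N * βa := by
      intro i j
      by_cases hij : i = j
      · subst hij
        rw [degMat, Matrix.diagonal_apply_eq]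
        refine (Finset.abs_sum_le_sum_abs _ _).trans ?_
        calc _ ≤ ∑ _j : Fin N, βa := Finset.sum_le_sum fun j _ => e1 k i j
          _ = N * βa := by simp
      · rw [degMat, Matrix.diagonal_apply_ne _ hij, abs_zero]
        positivity
    have hlap : ∀ i j, |S.lapl k ω i j| ≤ c₅ := fun i j =>
      (abs_sub _ _).trans (add_le_add (hdeg i j) (e1 k i j))
    have hsym : |S.laplSym k ω i.1 j.1| ≤ c₅ := by
      have h1 := abs_le.1 (hlap i.1 j.1)
      have h2 := abs_le.1 (hlap j.1 i.1)
      rw [laplSym, Matrix.smul_apply, Matrix.add_apply, Matrix.transpose_apply, smul_eq_mul, abs_le]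
      constructor <;> linarith [h1.1, h1.2, h2.1, h2.2]
    have hone : |(1 : Matrix (Fin n) (Fin n) ℝ) i.2 j.2| ≤ 1 := by
      rw [Matrix.one_apply]
      split_ifs <;> simp
    rw [Matrix.kroneckerMap_apply, abs_mul]
    have := mul_le_mul hsym hone (abs_nonneg _) h5
    linarith
  · filter_upwards [htraj] with ω ⟨e1, e2, e3⟩ k q i j hq
    refine (abs_entry_le_norm _ i j).trans ((Matrix.l2_opNorm_mul _ _).trans ?_)
    have hone : ‖(1 : Matrix (Fin N × Fin n) (Fin N × Fin n) ℝ)‖ ≤ 1 :=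
      opNorm_le_of_forall_act_le _ zero_le_one fun x => by rw [one_act, one_mul]
    have h1 : ‖(transProd (S.F ω) ((k : ℤ) - 1) ((k : ℤ) - q))⁻¹ - 1‖ ≤ ρ ^ d + 1 := by
      refine (norm_sub_le _ _).trans (add_le_add ?_ hone)
      exact (S.norm_transProd_inv_le hρ0 (fun t _ => (e3 t).2) q).trans (pow_le_pow_right₀ hρ1 hq)
    have := mul_le_mul (S.norm_Abar_le hβa.le (e1 k) q) h1 (norm_nonneg _) (by positivity)
    linarith

end Network
end CoopEst

theorem corollary2 {Ω : Type*} [MeasurableSpace Ω] (μ : Measure Ω) [IsProbabilityMeasure μ]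
    (N n d : ℕ) (p : Fin N → ℕ) (S : CoopEst.Network μ N n d p)
    (βa βH Ca : ℝ)
    (hA1a : S.NoiseIndep)
    (hA1b : S.NoiseMartingaleDiff)
    (hA2b : S.BoundedBy βa βH)
    (hA3a : S.GainsDecay)
    (hA3c : S.GainsSmall βa βH Ca)
    (h : ℕ) (hh : 0 < h) (θ : ℝ) (hθ : 0 < θ)
    (hlam : ∀ᵐ ω ∂μ, ∀ m : ℕ, θ ≤ S.lam h m ω - S.Delta h m ω) :
    S.ConvergesInMeanSquare := by
  -- Clearing denominators in the gain condition requires N > 0; with no nodes there is nothing to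
  -- prove.
  rcases Nat.eq_zero_or_pos N with rfl | hN
  · exact fun i => i.elim0
  · obtain ⟨c, hc⟩ := CoopEst.Network.exists_regular hN hA1a hA1b hA2b hA3a hA3c hh
    exact hc.convergesInMeanSquare hh hθ hlam
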